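/- Let $p$ be a prime and let $k$ be a field of characteristic $0$, complete with respect to a non-archimedean absolute value with $|p|<1$. Let $0<r_1<r_2$ and let $C(r_1,r_2)=\{\xi : r_1<|x(\xi)|<r_2\}$ be the open annulus in the Berkovich affine line over $k$ (the space of multiplicative seminorms on $k[x]$ extending the absolute value of $k$). For $r>0$ let $t_{0,r}$ be the point $\sum_i a_i x^i\mapsto\max_i|a_i|r^i$. Let $\mathscr H(r_1,r_2)$ be the Banach algebra of analytic elements on $C(r_1,r_2)$, that is, the completion, for the supremum norm on $C(r_1,r_2)$, of the algebra of rational functions in $k(x)$ without poles in $C(r_1,r_2)$. The derivation $d/dx$, and the functions $f\mapsto |f(t_{0,r})|$ for $r\in[r_1,r_2]$, extend to $\mathscr H(r_1,r_2)$ by continuity. Let $G$ be a $\mu\times\mu$ matrix with entries in $\mathscr H(r_1,r_2)$ and consider the system $\Sigma:\ \frac{d}{dx}\vec y=G\,\vec y$. Put $G_0=I_\mu$, $G_{s+1}=\frac{d}{dx}(G_s)+G_sG$ and $G_{[s]}=\frac1{s!}G_s$, and for $r\in[r_1,r_2]$ $$\widetilde R(t_{0,r},\Sigma)=\liminf_{s\to\infty}|G_{[s]}(t_{0,r})|^{-1/s}\in[0,\infty],\qquad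 R(t_{0,r},\Sigma)=\min\bigl(r,\widetilde R(t_{0,r},\Sigma)\bigr),$$ where $|\cdot|$ of a matrix is the maximum of the absolute values of its entries (and $0^{-1/s}=\infty$). Then $R(t_{0,r},\Sigma)>0$ for every $r\in[r_1,r_2]$, and the function $[r_1,r_2]\to\mathbb R_{>0}$, $r\mapsto R(t_{0,r},\Sigma)$, is continuous on the closed interval $[r_1,r_2]$, endpoints included. -/

import Mathlib

open Polynomial

namespace PadicDE

/-! ### The Berkovich affine line -/

/-- A point of the Berkovich affine line over `k`: a (non-archimedean) multiplicative seminorm on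
`k[X]` extending the absolute value of `k`. -/
structure BerkovichLine (k : Type*) [NormedField k] where
  toFun : k[X] → ℝ
  nonneg' : ∀ P, 0 ≤ toFun P
  map_C' : ∀ a, toFun (C a) = ‖a‖
  map_mul' : ∀ P Q, toFun (P * Q) = toFun P * toFun Q
  map_add_le_max' : ∀ P Q, toFun (P + Q) ≤ max (toFun P) (toFun Q)

section BerkovichLine

variable {k : Type*} [NormedField k]

namespace BerkovichLine

/-- `|P(ξ)|` for a polynomial `P`. -/
instance : CoeFun (BerkovichLine k) (fun _ => k[X] → ℝ) := ⟨toFun⟩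

variable (ξ : BerkovichLine k)

lemma nonneg (P : k[X]) : 0 ≤ ξ P := ξ.nonneg' P

lemma map_C (a : k) : ξ (C a) = ‖a‖ := ξ.map_C' a

lemma map_mul (P Q : k[X]) : ξ (P * Q) = ξ P * ξ Q := ξ.map_mul' P Q

lemma isNonarchimedean : IsNonarchimedean (ξ : k[X] → ℝ) := ξ.map_add_le_max'

lemma map_zero : ξ 0 = 0 := by simpa using ξ.map_C 0

lemma map_one : ξ 1 = 1 := by simpa using ξ.map_C 1

lemma map_neg (P : k[X]) : ξ (-P) = ξ P := by
  have : -P = C (-1) * P := by simp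
  rw [this, ξ.map_mul, ξ.map_C]; simp

lemma map_pow (P : k[X]) (n : ℕ) : ξ (P ^ n) = ξ P ^ n := by
  induction n with
  | zero => simp [ξ.map_one]
  | succ n ih => rw [pow_succ, ξ.map_mul, ih, pow_succ]

lemma map_C_mul_X_pow (a : k) (n : ℕ) : ξ (C a * X ^ n) = ‖a‖ * ξ X ^ n := by
  rw [ξ.map_mul, ξ.map_C, ξ.map_pow]

/-- `|f(ξ)|` for a rational function `f` without a pole at `ξ`. -/
noncomputable def absRat (f : RatFunc k) : ℝ := ξ f.num / ξ f.denom

lemma absRat_nonneg (f : RatFunc k) : 0 ≤ ξ.absRat f :=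
  div_nonneg (ξ.nonneg _) (ξ.nonneg _)

end BerkovichLine

/-- The absolute value of `k`. -/
noncomputable def absVal (k : Type*) [NormedField k] : AbsoluteValue k ℝ :=
  IsAbsoluteValue.toAbsoluteValue (norm : k → ℝ)

lemma absVal_apply (a : k) : absVal k a = ‖a‖ := rfl

lemma absVal_isNonarchimedean [IsUltrametricDist k] : IsNonarchimedean (absVal k) :=
  fun a b => IsUltrametricDist.norm_add_le_max a b

/-- The point `t_{0,r}`, the boundary point of the disk of radius `r` around `0`: the seminorm
`∑ aᵢ Xⁱ ↦ maxᵢ |aᵢ| rⁱ`. -/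
noncomputable def gaussPoint (k : Type*) [NormedField k] [IsUltrametricDist k] (r : ℝ)
    (hr : 0 < r) : BerkovichLine k where
  toFun P := P.gaussNorm (absVal k) r
  nonneg' P := P.gaussNorm_nonneg _ hr.le
  map_C' a := by simp [absVal_apply]
  map_mul' P Q := gaussNorm_mul absVal_isNonarchimedean hr P Q
  map_add_le_max' P Q := isNonarchimedean_gaussNorm _ absVal_isNonarchimedean hr.le P Q

end BerkovichLine

/-! ### Annuli and rational functions on them -/

/-- The radii `0 < r₁ < r₂` of an open annulus `C(r₁, r₂)`. -/
structure Annulus where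
  r₁ : ℝ
  r₂ : ℝ
  pos : 0 < r₁
  lt : r₁ < r₂

/-- The open annulus `C(r₁, r₂) = {ξ : r₁ < |x(ξ)| < r₂}` in the Berkovich affine line. -/
def Annulus.carrier (U : Annulus) (k : Type*) [NormedField k] : Set (BerkovichLine k) :=
  {ξ | U.r₁ < ξ X ∧ ξ X < U.r₂}

section helpers

variable {k : Type*} [NontriviallyNormedField k] [IsUltrametricDist k]

lemma gaussPoint_apply (r : ℝ) (hr : 0 < r) (P : k[X]) :
    gaussPoint k r hr P = P.gaussNorm (absVal k) r := rfl

lemma gaussPoint_X (r : ℝ) (hr : 0 < r) : gaussPoint k r hr X = r := by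
  rw [gaussPoint_apply, ← monomial_one_one_eq_X, gaussNorm_monomial]
  simp

lemma gaussPoint_mem (U : Annulus) {r : ℝ} (h₁ : U.r₁ < r) (h₂ : r < U.r₂) :
    gaussPoint k r (U.pos.trans h₁) ∈ U.carrier k := by
  simp [Annulus.carrier, gaussPoint_X, h₁, h₂]

/-- A seminorm is bounded by the Gauss norm of the same radius. -/
lemma BerkovichLine.le_gauss (ξ : BerkovichLine k) (hξ : 0 < ξ X) (P : k[X]) :
    ξ P ≤ gaussPoint k (ξ X) hξ P := by
  rw [gaussPoint_apply]
  obtain ⟨i, -, hi⟩ := IsNonarchimedean.finset_image_add ξ.map_zero ξ.nonneg ξ.isNonarchimedean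
    (fun i => C (P.coeff i) * X ^ i) P.support
  rw [← P.as_sum_support_C_mul_X_pow, ξ.map_C_mul_X_pow] at hi
  exact hi.trans (P.le_gaussNorm (absVal k) hξ.le i)

/-- The Gauss norm of the derivative. -/
lemma gaussPoint_derivative (r : ℝ) (hr : 0 < r) (P : k[X]) :
    gaussPoint k r hr (derivative P) ≤ gaussPoint k r hr P / r := by
  simp only [gaussPoint_apply]
  obtain ⟨i, hi⟩ := (derivative P).exists_eq_gaussNorm (absVal k) r
  rw [hi, le_div_iff₀ hr]
  have h := P.le_gaussNorm (absVal k) hr.le (i + 1)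
  refine le_trans ?_ h
  rw [coeff_derivative, pow_succ, ← mul_assoc]
  gcongr
  simp only [absVal_apply, norm_mul]
  have : ‖((i : k) + 1)‖ ≤ 1 := by exact_mod_cast IsUltrametricDist.norm_natCast_le_one k (i + 1)
  exact mul_le_of_le_one_right (norm_nonneg _) this

/-- `P` has a unique dominant monomial at radius `r`. -/
lemma exists_dominant {L : Type*} [NormedField L] [IsUltrametricDist L] {r : ℝ} (hr : 0 < r)
    (S : Multiset L) (hS : ∀ a ∈ S, ‖a‖ ≠ r) :
    ∃ j, ∀ i, i ≠ j → ‖(S.map (fun a => X - C a)).prod.coeff i‖ * r ^ i <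
      ‖(S.map (fun a => X - C a)).prod.coeff j‖ * r ^ j := by
  induction S using Multiset.induction with
  | empty =>
    refine ⟨0, fun i hi => ?_⟩
    simp [coeff_one, hi]
  | cons a S ih =>
    obtain ⟨j, hj⟩ := ih fun b hb => hS b (Multiset.mem_cons_of_mem hb)
    have ha := hS a (Multiset.mem_cons_self a S)
    rw [Multiset.map_cons, Multiset.prod_cons]
    generalize (S.map (fun a => X - C a)).prod = T at hj
    set M := ‖T.coeff j‖ * r ^ j with hM
    have hle : ∀ i, ‖T.coeff i‖ * r ^ i ≤ M := fun i => by
      by_cases h : i = j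
      · rw [h]
      · exact (hj i h).le
    have hM0 : 0 < M := lt_of_le_of_lt (by positivity) (hj (j + 1) (by simp))
    have hcoef : ∀ i, ((X - C a) * T).coeff (i + 1) = T.coeff i - a * T.coeff (i + 1) := by
      intro i; rw [sub_mul, coeff_sub, coeff_X_mul, coeff_C_mul]
    have hcoef0 : ((X - C a) * T).coeff 0 = 0 - a * T.coeff 0 := by
      rw [sub_mul, coeff_sub, coeff_C_mul]; simp
    have hsub : ∀ x y : L, ‖x - y‖ ≤ max ‖x‖ ‖y‖ := fun x y => by
      simpa [sub_eq_add_neg] using IsUltrametricDist.norm_add_le_max x (-y)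
    rcases lt_or_gt_of_ne ha with h | h
    · refine ⟨j + 1, ?_⟩
      have hval : ‖((X - C a) * T).coeff (j + 1)‖ * r ^ (j + 1) = r * M := by
        have h1 : ‖a * T.coeff (j + 1)‖ < ‖T.coeff j‖ := by
          have := hle (j + 1)
          rw [norm_mul]
          by_contra! hcon
          have h2 : ‖T.coeff j‖ * r ^ (j + 1) ≤ ‖a‖ * M := by
            calc ‖T.coeff j‖ * r ^ (j + 1) ≤ ‖a‖ * ‖T.coeff (j + 1)‖ * r ^ (j + 1) := by gcongr
              _ = ‖a‖ * (‖T.coeff (j + 1)‖ * r ^ (j + 1)) := by ring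
              _ ≤ _ := by gcongr
          have h3 : ‖T.coeff j‖ * r ^ (j + 1) = r * M := by rw [hM]; ring
          nlinarith
        rw [hcoef, sub_eq_add_neg, IsUltrametricDist.norm_add_eq_max_of_norm_ne_norm
          (by rw [norm_neg]; exact h1.ne'), norm_neg, max_eq_left h1.le, hM]
        ring
      intro i hi
      rw [hval]
      cases i with
      | zero =>
        rw [hcoef0, zero_sub, norm_neg, norm_mul, mul_assoc]
        have := hle 0
        calc ‖a‖ * (‖T.coeff 0‖ * r ^ 0) ≤ ‖a‖ * M := by gcongr
          _ < r * M := by gcongr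
      | succ i =>
        have hij : i ≠ j := fun h => hi (by rw [h])
        rw [hcoef]
        refine lt_of_le_of_lt (mul_le_mul_of_nonneg_right (hsub _ _) (by positivity)) ?_
        rw [max_mul_of_nonneg _ _ (by positivity)]
        refine max_lt ?_ ?_
        · have := hj i hij
          calc ‖T.coeff i‖ * r ^ (i + 1) = r * (‖T.coeff i‖ * r ^ i) := by ring
            _ < r * M := by gcongr
        · have := hle (i + 1)
          rw [norm_mul, mul_assoc]
          calc ‖a‖ * (‖T.coeff (i + 1)‖ * r ^ (i + 1)) ≤ ‖a‖ * M := by gcongr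
            _ < r * M := by gcongr
    · have ha0 : 0 < ‖a‖ := hr.trans h
      refine ⟨j, ?_⟩
      have hval : ‖((X - C a) * T).coeff j‖ * r ^ j = ‖a‖ * M := by
        cases j with
        | zero => rw [hcoef0, zero_sub, norm_neg, norm_mul, mul_assoc]
        | succ j =>
          have h1 : ‖T.coeff j‖ < ‖a * T.coeff (j + 1)‖ := by
            have := hle j
            rw [norm_mul]
            by_contra! hcon
            have h2 : ‖a‖ * M ≤ r * M := by
              calc ‖a‖ * M = (‖a‖ * ‖T.coeff (j + 1)‖) * r ^ (j + 1) := by rw [hM]; ring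
                _ ≤ ‖T.coeff j‖ * r ^ (j + 1) := by gcongr
                _ = r * (‖T.coeff j‖ * r ^ j) := by ring
                _ ≤ _ := by gcongr
            nlinarith
          rw [hcoef, sub_eq_add_neg, IsUltrametricDist.norm_add_eq_max_of_norm_ne_norm
            (by rw [norm_neg]; exact h1.ne), norm_neg, max_eq_right h1.le, hM, norm_mul]
          ring
      intro i hi
      rw [hval]
      cases i with
      | zero =>
        rw [hcoef0, zero_sub, norm_neg, norm_mul, mul_assoc]
        have := hj 0 hi
        gcongr
      | succ i =>
        rw [hcoef]
        refine lt_of_le_of_lt (mul_le_mul_of_nonneg_right (hsub _ _) (by positivity)) ?_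
        rw [max_mul_of_nonneg _ _ (by positivity)]
        refine max_lt ?_ ?_
        · have := hle i
          calc ‖T.coeff i‖ * r ^ (i + 1) = r * (‖T.coeff i‖ * r ^ i) := by ring
            _ ≤ r * M := by gcongr
            _ < ‖a‖ * M := by gcongr
        · have := hj (i + 1) hi
          rw [norm_mul, mul_assoc]
          gcongr

variable [CompleteSpace k]

/-- The point of the Berkovich line given by an algebraic element. -/
noncomputable def classicalPoint (a : AlgebraicClosure k) : BerkovichLine k where
  toFun P := spectralNorm k (AlgebraicClosure k) (aeval a P)
  nonneg' P := spectralNorm_nonneg _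
  map_C' c := by rw [aeval_C, spectralNorm_extends]
  map_mul' P Q := by
    simp only [_root_.map_mul, ← spectralMulAlgNorm_def]
  map_add_le_max' P Q := by
    rw [map_add]; exact isNonarchimedean_spectralNorm _ _

/-- A monic polynomial without zeros in an annulus has Gauss absolute values there. -/
lemma BerkovichLine.gauss_le_of_no_zero (U : Annulus) (Q : k[X]) (hQ : Q.Monic)
    (h0 : ∀ η ∈ U.carrier k, η Q ≠ 0) (ξ : BerkovichLine k) (hξ : ξ ∈ U.carrier k) :
    gaussPoint k (ξ X) (U.pos.trans hξ.1) Q ≤ ξ Q := by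
  have hr : 0 < ξ X := U.pos.trans hξ.1
  let := spectralNorm.normedField k (AlgebraicClosure k)
  have hnorm : ∀ x : AlgebraicClosure k, ‖x‖ = spectralNorm k (AlgebraicClosure k) x :=
    fun _ => rfl
  have : IsUltrametricDist (AlgebraicClosure k) :=
    IsUltrametricDist.isUltrametricDist_of_isNonarchimedean_norm
      (isNonarchimedean_spectralNorm (K := k) (L := AlgebraicClosure k))
  have hsplit := IsAlgClosed.splits (Q.map (algebraMap k (AlgebraicClosure k)))
  have hprod := hsplit.eq_prod_roots_of_monic (hQ.map _)
  obtain ⟨j, hj⟩ := exists_dominant hr (Q.map (algebraMap k (AlgebraicClosure k))).roots (by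
    intro a ha haeq
    refine h0 (classicalPoint a) ?_ ?_
    · have : classicalPoint a X = ξ X := by
        rw [← haeq, hnorm]
        simp [classicalPoint]
      exact ⟨by rw [this]; exact hξ.1, by rw [this]; exact hξ.2⟩
    · have : aeval a Q = 0 := by
        rw [aeval_def, ← eval_map]; exact (mem_roots'.1 ha).2
      simp [classicalPoint, this, spectralNorm_zero])
  rw [← hprod] at hj
  have hj' : ∀ i, i ≠ j → ‖Q.coeff i‖ * ξ X ^ i < ‖Q.coeff j‖ * ξ X ^ j := by
    intro i hi
    have := hj i hi
    simpa only [coeff_map, hnorm, spectralNorm_extends] using this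
  have hjs : j ∈ Q.support := by
    rw [mem_support_iff]
    intro h
    have := hj' (j + 1) (by simp)
    rw [h, norm_zero, zero_mul] at this
    exact absurd this (not_lt.2 (by positivity))
  have hval : ξ Q = ‖Q.coeff j‖ * ξ X ^ j := by
    conv_lhs => rw [Q.as_sum_support_C_mul_X_pow]
    rw [IsNonarchimedean.apply_sum_eq_of_lt ξ.isNonarchimedean (fun a => (ξ.map_neg a).symm) hjs,
      ξ.map_C_mul_X_pow]
    intro i _ hi
    rw [ξ.map_C_mul_X_pow, ξ.map_C_mul_X_pow]
    exact hj' i hi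
  rw [hval, gaussPoint_apply]
  obtain ⟨i, hi⟩ := Q.exists_eq_gaussNorm (absVal k) (ξ X)
  rw [hi]
  by_cases h : i = j
  · rw [h, absVal_apply]
  · exact (hj' i h).le

end helpers

/-! ### The ring of rational functions without poles in the annulus -/

section RatFunc

variable {k : Type*} [NormedField k]

lemma BerkovichLine.map_ne_zero_of_dvd (ξ : BerkovichLine k) {P Q : k[X]} (h : P ∣ Q)
    (hQ : ξ Q ≠ 0) : ξ P ≠ 0 := by
  obtain ⟨R, rfl⟩ := h
  rw [ξ.map_mul] at hQ
  exact left_ne_zero_of_mul hQ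

lemma BerkovichLine.absRat_eq (ξ : BerkovichLine k) {f : RatFunc k} {a b : k[X]} (hb : ξ b ≠ 0)
    (hf : f = algebraMap k[X] (RatFunc k) a / algebraMap k[X] (RatFunc k) b) :
    ξ f.denom ≠ 0 ∧ ξ.absRat f = ξ a / ξ b := by
  have hb0 : b ≠ 0 := by rintro rfl; exact hb ξ.map_zero
  have hd : ξ f.denom ≠ 0 := ξ.map_ne_zero_of_dvd ((RatFunc.denom_dvd hb0).2 ⟨a, hf⟩) hb
  refine ⟨hd, ?_⟩
  have := (RatFunc.num_mul_eq_mul_denom_iff (x := f) (p := a) hb0).2 hf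
  rw [BerkovichLine.absRat, div_eq_div_iff hd hb, ← ξ.map_mul, ← ξ.map_mul, this]

/-- The derivative `d/dx` of a rational function, by the quotient rule. -/
noncomputable def ratDeriv (f : RatFunc k) : RatFunc k :=
  algebraMap k[X] (RatFunc k) (derivative f.num * f.denom - f.num * derivative f.denom) /
    algebraMap k[X] (RatFunc k) (f.denom ^ 2)

lemma ratDeriv_eq {f : RatFunc k} {a b : k[X]} (hb : b ≠ 0)
    (hf : f = algebraMap k[X] (RatFunc k) a / algebraMap k[X] (RatFunc k) b) :
    ratDeriv f = algebraMap k[X] (RatFunc k) (derivative a * b - a * derivative b) /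
      algebraMap k[X] (RatFunc k) (b ^ 2) := by
  have h := (RatFunc.num_mul_eq_mul_denom_iff (x := f) (p := a) hb).2 hf
  have h' := congrArg derivative h
  simp only [derivative_mul] at h'
  have hd := f.denom_ne_zero
  have e1 : algebraMap k[X] (RatFunc k) (f.denom ^ 2) ≠ 0 := RatFunc.algebraMap_ne_zero (by simp [hd])
  have e2 : algebraMap k[X] (RatFunc k) (b ^ 2) ≠ 0 := RatFunc.algebraMap_ne_zero (by simp [hb])
  rw [ratDeriv, div_eq_div_iff e1 e2, ← _root_.map_mul, ← _root_.map_mul]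
  congr 1
  linear_combination (f.denom * b) * h' - (f.denom * derivative b + b * derivative f.denom) * h

lemma ratDeriv_sub (f g : RatFunc k) : ratDeriv (f - g) = ratDeriv f - ratDeriv g := by
  have hf := f.denom_ne_zero
  have hg := g.denom_ne_zero
  have ef : algebraMap k[X] (RatFunc k) f.denom ≠ 0 := RatFunc.algebraMap_ne_zero hf
  have eg : algebraMap k[X] (RatFunc k) g.denom ≠ 0 := RatFunc.algebraMap_ne_zero hg
  have h : f - g = algebraMap k[X] (RatFunc k) (f.num * g.denom - f.denom * g.num) /
      algebraMap k[X] (RatFunc k) (f.denom * g.denom) := by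
    conv_lhs => rw [← f.num_div_denom, ← g.num_div_denom, div_sub_div _ _ ef eg]
    simp
  rw [ratDeriv_eq (mul_ne_zero hf hg) h, ratDeriv, ratDeriv, div_sub_div _ _ (by simpa using ef)
    (by simpa using eg), div_eq_div_iff (by simp [ef, eg]) (by simp [ef, eg])]
  simp only [_root_.map_mul, map_sub, map_pow, derivative_mul, map_add]
  ring

variable (k) in
/-- The `k`-algebra of rational functions having no pole in `C(r₁, r₂)`. -/
noncomputable def ratFuncSubalgebra (U : Annulus) : Subalgebra k (RatFunc k) where
  carrier := {f | ∀ ξ ∈ U.carrier k, ξ f.denom ≠ 0}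
  mul_mem' {f g} hf hg ξ hξ := ξ.map_ne_zero_of_dvd (RatFunc.denom_mul_dvd f g) (by
    rw [ξ.map_mul]; exact mul_ne_zero (hf ξ hξ) (hg ξ hξ))
  add_mem' {f g} hf hg ξ hξ := ξ.map_ne_zero_of_dvd (RatFunc.denom_add_dvd f g) (by
    rw [ξ.map_mul]; exact mul_ne_zero (hf ξ hξ) (hg ξ hξ))
  algebraMap_mem' a ξ _ := by
    rw [IsScalarTower.algebraMap_apply k k[X] (RatFunc k), RatFunc.denom_algebraMap, ξ.map_one]
    exact one_ne_zero

variable (k) in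
/-- The `k`-algebra of rational functions having no pole in `C(r₁, r₂)`, as a type. -/
def RatFuncOn (U : Annulus) : Type _ := ratFuncSubalgebra k U

namespace RatFuncOn

variable {U : Annulus}

noncomputable instance : CommRing (RatFuncOn k U) := inferInstanceAs (CommRing (ratFuncSubalgebra k U))

noncomputable instance : Algebra k (RatFuncOn k U) :=
  inferInstanceAs (Algebra k (ratFuncSubalgebra k U))

/-- The underlying rational function. -/
def toRat (f : RatFuncOn k U) : RatFunc k := Subtype.val f

/-- `|f(ξ)|`. -/
noncomputable def absAt (ξ : BerkovichLine k) (f : RatFuncOn k U) : ℝ := ξ.absRat f.toRat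

/-- The supremum norm `‖f‖_U = sup_{ξ ∈ U} |f(ξ)|` on `U = C(r₁, r₂)`. -/
noncomputable def supNorm (f : RatFuncOn k U) : ℝ := ⨆ ξ : U.carrier k, f.absAt ξ.1

lemma supNorm_nonneg (f : RatFuncOn k U) : 0 ≤ f.supNorm :=
  Real.iSup_nonneg fun ξ => ξ.1.absRat_nonneg _

section absAt

variable {ξ : BerkovichLine k}

lemma num_div_denom (f : RatFuncOn k U) :
    f.toRat = algebraMap k[X] (RatFunc k) f.toRat.num / algebraMap k[X] (RatFunc k) f.toRat.denom :=
  (RatFunc.num_div_denom _).symm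

lemma denom_ne_zero (f : RatFuncOn k U) : algebraMap k[X] (RatFunc k) f.toRat.denom ≠ 0 :=
  RatFunc.algebraMap_ne_zero (RatFunc.denom_ne_zero _)

lemma absAt_nonneg (f : RatFuncOn k U) : 0 ≤ f.absAt ξ := ξ.absRat_nonneg _

lemma absAt_mul (f g : RatFuncOn k U) (hf : ξ f.toRat.denom ≠ 0) (hg : ξ g.toRat.denom ≠ 0) :
    (f * g).absAt ξ = f.absAt ξ * g.absAt ξ := by
  have h : (f * g).toRat = algebraMap k[X] (RatFunc k) (f.toRat.num * g.toRat.num) /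
      algebraMap k[X] (RatFunc k) (f.toRat.denom * g.toRat.denom) := by
    rw [_root_.map_mul, _root_.map_mul, ← div_mul_div_comm, ← num_div_denom, ← num_div_denom]
    rfl
  rw [absAt, (ξ.absRat_eq (by rw [ξ.map_mul]; exact mul_ne_zero hf hg) h).2, ξ.map_mul, ξ.map_mul,
    ← div_mul_div_comm]
  rfl

lemma absAt_add_le (f g : RatFuncOn k U) (hf : ξ f.toRat.denom ≠ 0) (hg : ξ g.toRat.denom ≠ 0) :
    (f + g).absAt ξ ≤ max (f.absAt ξ) (g.absAt ξ) := by
  have h : (f + g).toRat = algebraMap k[X] (RatFunc k)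
        (f.toRat.num * g.toRat.denom + f.toRat.denom * g.toRat.num) /
      algebraMap k[X] (RatFunc k) (f.toRat.denom * g.toRat.denom) := by
    rw [map_add, _root_.map_mul, _root_.map_mul, _root_.map_mul,
      ← div_add_div _ _ f.denom_ne_zero g.denom_ne_zero, ← num_div_denom, ← num_div_denom]
    rfl
  have hf' := lt_of_le_of_ne (ξ.nonneg _) hf.symm
  have hg' := lt_of_le_of_ne (ξ.nonneg _) hg.symm
  rw [absAt, (ξ.absRat_eq (by rw [ξ.map_mul]; exact mul_ne_zero hf hg) h).2, ξ.map_mul,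
    div_le_iff₀ (mul_pos hf' hg')]
  refine (ξ.map_add_le_max' _ _).trans (le_of_eq ?_)
  rw [ξ.map_mul, ξ.map_mul, max_mul_of_nonneg _ _ (mul_pos hf' hg').le]
  simp only [absAt, BerkovichLine.absRat]
  congr 1 <;> field_simp

lemma absAt_neg (f : RatFuncOn k U) (hf : ξ f.toRat.denom ≠ 0) : (-f).absAt ξ = f.absAt ξ := by
  have h : (-f).toRat = algebraMap k[X] (RatFunc k) (-f.toRat.num) /
      algebraMap k[X] (RatFunc k) f.toRat.denom := by
    rw [_root_.map_neg, neg_div, ← num_div_denom]; rfl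
  rw [absAt, (ξ.absRat_eq hf h).2, ξ.map_neg]; rfl

lemma absAt_zero : (0 : RatFuncOn k U).absAt ξ = 0 := by
  change ξ.absRat 0 = 0
  simp [BerkovichLine.absRat, ξ.map_zero]

lemma absAt_algebraMap (a : k) : (algebraMap k (RatFuncOn k U) a).absAt ξ = ‖a‖ := by
  change ξ.absRat (algebraMap k (RatFunc k) a) = _
  rw [IsScalarTower.algebraMap_apply k k[X] (RatFunc k), BerkovichLine.absRat,
    RatFunc.num_algebraMap, RatFunc.denom_algebraMap, ξ.map_one, div_one]
  exact ξ.map_C a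

end absAt

end RatFuncOn

end RatFunc

section Norm

variable {k : Type*} [NontriviallyNormedField k] [IsUltrametricDist k] [CompleteSpace k]

namespace RatFuncOn

variable {U : Annulus}

lemma denom_ne (f : RatFuncOn k U) {ξ : BerkovichLine k} (hξ : ξ ∈ U.carrier k) :
    ξ f.toRat.denom ≠ 0 := f.2 ξ hξ

/-- On the annulus, `|f(ξ)|` is at most the value at the Gauss point of the same radius. -/
lemma absAt_le_gauss (f : RatFuncOn k U) {ξ : BerkovichLine k} (hξ : ξ ∈ U.carrier k) :
    f.absAt ξ ≤ f.absAt (gaussPoint k (ξ X) (U.pos.trans hξ.1)) := by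
  have hr : 0 < ξ X := U.pos.trans hξ.1
  have hg : gaussPoint k (ξ X) hr ∈ U.carrier k := gaussPoint_mem U hξ.1 hξ.2
  refine div_le_div₀ (BerkovichLine.nonneg _ _) (ξ.le_gauss hr _) ?_ ?_
  · exact lt_of_le_of_ne (BerkovichLine.nonneg _ _) (f.denom_ne hg).symm
  · exact ξ.gauss_le_of_no_zero U _ (RatFunc.monic_denom _) (fun η hη => f.denom_ne hη) hξ

lemma bddAbove (f : RatFuncOn k U) : BddAbove (Set.range fun ξ : U.carrier k => f.absAt ξ.1) := by
  set n := f.toRat.denom.natDegree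
  have h2 : 0 < U.r₂ := U.pos.trans U.lt
  refine ⟨gaussPoint k U.r₂ h2 f.toRat.num / U.r₁ ^ n, ?_⟩
  rintro _ ⟨⟨ξ, hξ⟩, rfl⟩
  refine (f.absAt_le_gauss hξ).trans ?_
  refine div_le_div₀ (BerkovichLine.nonneg _ _) ?_ (pow_pos U.pos _) ?_
  · simp only [gaussPoint_apply]
    obtain ⟨i, hi⟩ := f.toRat.num.exists_eq_gaussNorm (absVal k) (ξ X)
    rw [hi]
    refine le_trans ?_ (f.toRat.num.le_gaussNorm (absVal k) h2.le i)
    have h0 : 0 ≤ ξ X := ξ.nonneg X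
    have := hξ.2.le
    gcongr
  · refine le_trans ?_ (f.toRat.denom.le_gaussNorm (absVal k) (ξ.nonneg X) n)
    have : f.toRat.denom.coeff n = 1 := RatFunc.monic_denom f.toRat
    rw [this, _root_.map_one, one_mul]
    exact pow_le_pow_left₀ U.pos.le hξ.1.le _

lemma absAt_le_supNorm (f : RatFuncOn k U) {ξ : BerkovichLine k} (hξ : ξ ∈ U.carrier k) :
    f.absAt ξ ≤ f.supNorm :=
  le_ciSup (f := fun ξ : U.carrier k => f.absAt ξ.1) f.bddAbove ⟨ξ, hξ⟩

lemma supNorm_le (f : RatFuncOn k U) {c : ℝ} (hc : 0 ≤ c)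
    (h : ∀ ξ ∈ U.carrier k, f.absAt ξ ≤ c) : f.supNorm ≤ c :=
  Real.iSup_le (fun ξ => h ξ.1 ξ.2) hc

/-- The supremum norm as a ring seminorm. -/
noncomputable def supSeminorm (k : Type*) [NontriviallyNormedField k] [IsUltrametricDist k]
    [CompleteSpace k] (U : Annulus) : RingSeminorm (RatFuncOn k U) where
  toFun := supNorm
  map_zero' := le_antisymm (supNorm_le _ le_rfl fun ξ _ => absAt_zero.le) (supNorm_nonneg _)
  add_le' f g := by
    refine supNorm_le _ (add_nonneg f.supNorm_nonneg g.supNorm_nonneg) fun ξ hξ => ?_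
    refine (absAt_add_le f g (f.denom_ne hξ) (g.denom_ne hξ)).trans (max_le ?_ ?_)
    · exact (f.absAt_le_supNorm hξ).trans (le_add_of_nonneg_right g.supNorm_nonneg)
    · exact (g.absAt_le_supNorm hξ).trans (le_add_of_nonneg_left f.supNorm_nonneg)
  neg' f := by
    have : ∀ g : RatFuncOn k U, (-g).supNorm ≤ g.supNorm := fun g =>
      supNorm_le _ g.supNorm_nonneg fun ξ hξ => by
        rw [absAt_neg g (g.denom_ne hξ)]; exact g.absAt_le_supNorm hξ
    exact le_antisymm (this f) (by simpa using this (-f))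
  mul_le' f g := by
    refine supNorm_le _ (mul_nonneg f.supNorm_nonneg g.supNorm_nonneg) fun ξ hξ => ?_
    rw [absAt_mul f g (f.denom_ne hξ) (g.denom_ne hξ)]
    exact mul_le_mul (f.absAt_le_supNorm hξ) (g.absAt_le_supNorm hξ) g.absAt_nonneg f.supNorm_nonneg

/-- The norm on `RatFuncOn k U` is the supremum norm on the annulus. -/
noncomputable instance : SeminormedCommRing (RatFuncOn k U) :=
  { (supSeminorm k U).toSeminormedRing with mul_comm := mul_comm }

lemma norm_def (f : RatFuncOn k U) : ‖f‖ = f.supNorm := rfl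

noncomputable instance : NormedAlgebra k (RatFuncOn k U) where
  norm_smul_le a f := by
    rw [Algebra.smul_def]
    refine (norm_mul_le _ _).trans (mul_le_mul_of_nonneg_right ?_ (norm_nonneg _))
    exact supNorm_le _ (norm_nonneg _) fun ξ _ => absAt_algebraMap a |>.le

/-- The derivation `d/dx`. -/
noncomputable def deriv (f : RatFuncOn k U) : RatFuncOn k U :=
  ⟨ratDeriv f.toRat, fun ξ hξ => (ξ.absRat_eq (b := f.toRat.denom ^ 2)
    (by rw [ξ.map_pow]; exact pow_ne_zero _ (f.denom_ne hξ)) rfl).1⟩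

lemma deriv_sub (f g : RatFuncOn k U) : (f - g).deriv = f.deriv - g.deriv :=
  Subtype.ext (ratDeriv_sub _ _)

lemma norm_deriv_le (f : RatFuncOn k U) : ‖f.deriv‖ ≤ ‖f‖ / U.r₁ := by
  refine supNorm_le _ (div_nonneg (norm_nonneg _) U.pos.le) fun ξ hξ => ?_
  have hr : 0 < ξ X := U.pos.trans hξ.1
  have hg : gaussPoint k (ξ X) hr ∈ U.carrier k := gaussPoint_mem U hξ.1 hξ.2
  have hle : f.absAt (gaussPoint k (ξ X) hr) ≤ ‖f‖ := f.absAt_le_supNorm hg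
  refine (f.deriv.absAt_le_gauss hξ).trans ?_
  have hd := f.denom_ne hg
  have hdpos := lt_of_le_of_ne (BerkovichLine.nonneg _ _) hd.symm
  set η := gaussPoint k (ξ X) hr with hη
  have e : f.deriv.absAt η = _ := (η.absRat_eq (b := f.toRat.denom ^ 2)
    (by rw [η.map_pow]; exact pow_ne_zero _ hd) rfl).2
  have key : η (derivative f.toRat.num * f.toRat.denom - f.toRat.num * derivative f.toRat.denom) ≤
      η f.toRat.num * η f.toRat.denom / ξ X := by
    rw [sub_eq_add_neg]
    refine (η.map_add_le_max' _ _).trans (max_le ?_ ?_)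
    · rw [η.map_mul']
      have := gaussPoint_derivative (ξ X) hr f.toRat.num
      calc _ ≤ η f.toRat.num / ξ X * η f.toRat.denom := by gcongr
        _ = _ := by ring
    · change η (-_) ≤ _
      rw [η.map_neg, η.map_mul]
      have := gaussPoint_derivative (ξ X) hr f.toRat.denom
      have h0 := η.nonneg f.toRat.num
      calc _ ≤ η f.toRat.num * (η f.toRat.denom / ξ X) := by gcongr
        _ = _ := by ring
  rw [e, η.map_pow, div_le_iff₀ (by positivity)]
  refine key.trans ?_
  have h1 : η f.toRat.num ≤ ‖f‖ * η f.toRat.denom := by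
    rwa [absAt, BerkovichLine.absRat, div_le_iff₀ hdpos] at hle
  calc η f.toRat.num * η f.toRat.denom / ξ X
      ≤ (‖f‖ * η f.toRat.denom) * η f.toRat.denom / U.r₁ := by
        have := hξ.1.le
        have := U.pos
        gcongr
    _ = _ := by ring

lemma uniformContinuous_deriv : UniformContinuous (deriv : RatFuncOn k U → RatFuncOn k U) := by
  refine (LipschitzWith.of_dist_le_mul (K := U.r₁⁻¹.toNNReal)
    fun f g => ?_).uniformContinuous
  rw [dist_eq_norm, dist_eq_norm, ← deriv_sub, Real.coe_toNNReal _ (inv_nonneg.2 U.pos.le), inv_mul_eq_div]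
  exact norm_deriv_le _

/-- The Gauss points of radius `r ∈ [r₁, r₂]`, endpoints included, are limits of points of the
annulus, and `|f(t_{0,r})| ≤ ‖f‖_U` there. -/
lemma absAt_gaussPoint_le (f : RatFuncOn k U) {r : ℝ} (hr : r ∈ Set.Icc U.r₁ U.r₂) :
    f.absAt (gaussPoint k r (U.pos.trans_le hr.1)) ≤ ‖f‖ := by
  have hpos : ∀ {t : ℝ}, t ∈ Set.Icc U.r₁ U.r₂ → 0 < t := fun ht => U.pos.trans_le ht.1
  have hd : 0 < gaussPoint k r (hpos hr) f.toRat.denom := by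
    refine lt_of_le_of_ne (BerkovichLine.nonneg _ _) (Ne.symm ?_)
    rw [gaussPoint_apply, Ne, gaussNorm_eq_zero_iff _ _ (fun x hx => by simpa using hx) (hpos hr)]
    exact RatFunc.denom_ne_zero _
  rw [absAt, BerkovichLine.absRat, div_le_iff₀ hd, gaussPoint_apply, gaussPoint_apply]
  obtain ⟨i, hi⟩ := f.toRat.num.exists_eq_gaussNorm (absVal k) r
  obtain ⟨j, hj⟩ := f.toRat.denom.exists_eq_gaussNorm (absVal k) r
  rw [hi]
  have hcl : r ∈ closure (Set.Ioo U.r₁ U.r₂) := by rwa [closure_Ioo U.lt.ne]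
  have hcont : ∀ P : k[X], Continuous fun t : ℝ =>
      (if h : P.support.Nonempty then P.support.sup' h fun i => absVal k (P.coeff i) * t ^ i
        else 0 : ℝ) := by
    intro P
    by_cases h : P.support.Nonempty
    · simp only [h, dif_pos]
      exact Continuous.finset_sup'_apply h fun i _ => by fun_prop
    · simp only [h, dif_neg, not_false_eq_true]
      exact continuous_const
  have hclosed : IsClosed {t : ℝ | absVal k (f.toRat.num.coeff i) * t ^ i ≤
      ‖f‖ * f.toRat.denom.gaussNorm (absVal k) t} :=
    isClosed_le (by fun_prop) (continuous_const.mul (hcont f.toRat.denom))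
  refine hclosed.closure_subset_iff.2 (fun t ht => ?_) hcl
  have ht0 : 0 < t := U.pos.trans ht.1
  have hmem := gaussPoint_mem (k := k) U ht.1 ht.2
  have h := f.absAt_le_supNorm hmem
  rw [absAt, BerkovichLine.absRat, div_le_iff₀ (lt_of_le_of_ne (BerkovichLine.nonneg _ _)
    (f.denom_ne hmem).symm)] at h
  exact (f.toRat.num.le_gaussNorm (absVal k) ht0.le i).trans h

lemma gaussPoint_denom_ne (f : RatFuncOn k U) (r : ℝ) (hr : 0 < r) :
    gaussPoint k r hr f.toRat.denom ≠ 0 := by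
  rw [gaussPoint_apply, Ne, gaussNorm_eq_zero_iff _ _ (fun x hx => by simpa using hx) hr]
  exact RatFunc.denom_ne_zero _

/-- `f ↦ |f(t_{0,r})|` is uniformly continuous for the supremum norm, for `r ∈ [r₁, r₂]`. -/
lemma uniformContinuous_absAt {r : ℝ} (hr : r ∈ Set.Icc U.r₁ U.r₂) :
    UniformContinuous fun f : RatFuncOn k U => f.absAt (gaussPoint k r (U.pos.trans_le hr.1)) := by
  have key : ∀ f g : RatFuncOn k U, f.absAt (gaussPoint k r (U.pos.trans_le hr.1)) ≤
      g.absAt (gaussPoint k r (U.pos.trans_le hr.1)) + dist f g := by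
    intro f g
    have h := absAt_add_le (ξ := gaussPoint k r (U.pos.trans_le hr.1)) (f - g) g
      (gaussPoint_denom_ne _ _ _) (gaussPoint_denom_ne _ _ _)
    rw [sub_add_cancel] at h
    refine h.trans (max_le ?_ ?_)
    · rw [dist_eq_norm]
      exact ((f - g).absAt_gaussPoint_le hr).trans (le_add_of_nonneg_left (absAt_nonneg _))
    · exact le_add_of_nonneg_right dist_nonneg
  refine (LipschitzWith.of_dist_le_mul (K := 1) fun f g => ?_).uniformContinuous
  rw [Real.dist_eq, abs_le, NNReal.coe_one, one_mul]
  constructor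
  · have := key g f
    rw [dist_comm] at this
    linarith
  · have := key f g
    linarith

end RatFuncOn

/-! ### Analytic elements -/

variable (k) in
/-- The Banach algebra `ℋ(r₁, r₂)` of analytic elements on `C(r₁, r₂)`: the completion, for the
supremum norm on `C(r₁, r₂)`, of the algebra of rational functions without poles there. -/
abbrev AnalyticElement (U : Annulus) : Type _ := UniformSpace.Completion (RatFuncOn k U)

namespace AnalyticElement

variable {U : Annulus}

/-- The derivation `d/dx` of `ℋ(r₁, r₂)`, extending that of rational functions by continuity. -/
noncomputable def deriv : AnalyticElement k U → AnalyticElement k U :=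
  UniformSpace.Completion.map RatFuncOn.deriv

/-- The absolute value `|h(ξ)|` of an analytic element, extending `f ↦ |f(ξ)|` by continuity; used
for `ξ` in the annulus and for the two points `t_{0,r₁}`, `t_{0,r₂}` of its closure. -/
noncomputable def absAt (ξ : BerkovichLine k) : AnalyticElement k U → ℝ :=
  UniformSpace.Completion.extension fun f => f.absAt ξ

lemma deriv_coe (f : RatFuncOn k U) : deriv (f : AnalyticElement k U) = (f.deriv : RatFuncOn k U) :=
  UniformSpace.Completion.map_coe RatFuncOn.uniformContinuous_deriv f

lemma absAt_coe (f : RatFuncOn k U) {r : ℝ} (hr : r ∈ Set.Icc U.r₁ U.r₂) :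
    absAt (gaussPoint k r (U.pos.trans_le hr.1)) (f : AnalyticElement k U) =
      f.absAt (gaussPoint k r (U.pos.trans_le hr.1)) :=
  UniformSpace.Completion.extension_coe (RatFuncOn.uniformContinuous_absAt hr) f

end AnalyticElement

/-! ### Differential systems `dy/dx = G y` and their radius of convergence -/

namespace System

variable {U : Annulus} {μ : ℕ}

/-- The matrices `G_s` with `(d/dx)^s y = G_s y` for every solution of `dy/dx = G y`:
`G_0 = 1` and `G_{s+1} = d/dx (G_s) + G_s G`. -/
noncomputable def iter (G : Matrix (Fin μ) (Fin μ) (AnalyticElement k U)) :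
    ℕ → Matrix (Fin μ) (Fin μ) (AnalyticElement k U)
  | 0 => 1
  | s + 1 => (iter G s).map AnalyticElement.deriv + iter G s * G

/-- `G_[s] = G_s / s!`, the coefficients of the Taylor series of the fundamental solution. -/
noncomputable def dividedIter (G : Matrix (Fin μ) (Fin μ) (AnalyticElement k U)) (s : ℕ) :
    Matrix (Fin μ) (Fin μ) (AnalyticElement k U) :=
  ((s.factorial : k)⁻¹) • iter G s

/-- `|M(ξ)|`, the maximum of the absolute values at `ξ` of the entries of `M`. -/
noncomputable def matAbsAt (ξ : BerkovichLine k)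
    (M : Matrix (Fin μ) (Fin μ) (AnalyticElement k U)) : ℝ :=
  ⨆ ij : Fin μ × Fin μ, AnalyticElement.absAt ξ (M ij.1 ij.2)

/-- `R̃(ξ, Σ) = liminf_{s → ∞} |G_[s](ξ)|^{-1/s} ∈ [0, ∞]`. -/
noncomputable def radiusTilde (G : Matrix (Fin μ) (Fin μ) (AnalyticElement k U))
    (ξ : BerkovichLine k) : ENNReal :=
  Filter.liminf (fun s : ℕ => ENNReal.ofReal (matAbsAt ξ (dividedIter G s)) ^ (-(1 / (s : ℝ))))
    Filter.atTop

/-- `R(t_{0,r}, Σ) = min (r, R̃(t_{0,r}, Σ))`. -/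
noncomputable def radius (G : Matrix (Fin μ) (Fin μ) (AnalyticElement k U)) (r : ℝ)
    (hr : 0 < r) : ℝ :=
  (min (ENNReal.ofReal r) (radiusTilde G (gaussPoint k r hr))).toReal

end System

end Norm

end PadicDE

/-!
The radius of convergence at `t_{0,r}` is shown to be a uniform limit of continuous functions of
`r ∈ [r₁, r₂]`, so that the endpoints need no separate treatment. Let `ω = |p|^{1/(p-1)}` and, for
`n = p^h`, let `N_n(r)` be the maximum of `1` and of `r^j |G_[j](t_{0,r})|` for `j ≤ n`
(`System.growth`); it is continuous and `≥ 1`. The radius `R` satisfies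

  `ω r^n ≤ R^n N_n(r) ≤ |p|^{-hμ} c r^n`

with `c` independent of `r` and `h`. Taking logarithms and dividing by `n = p^h`, `log R` differs
from `log r - (1/n) log N_n(r)` by a quantity of size `O(h / p^h)`, uniformly in `r`.

The lower bound (`System.mul_pow_le_radius_pow`) comes from the identity
`G_{n+s} = ∑ᵢ (n choose i) (d/dx)^i (G_s) G_{n-i}` (`sysDer_iterate_add`), which gives
`|G_{n+s}| ≤ |n!| r^{-n} N_n(r) |G_s|`, and from `|s!| ≥ ω^s` and `ω |n!| = ω^n` for `n = p^h`.

The upper bound (`System.radius_pow_mul_growth_le`) is the Dwork–Robba bound for systems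
(`norm_sysDer_iterate_le`): for `ρ < R` and `s ≤ p^h`,
`ρ^s |G_[s]| ≤ |p|^{-hμ} max_{i < μ} ρ^i |G_[i]|`. Over a field with a derivation `D` such that
`|D^s x / s!| ≤ ρ^{-s} |x|`, the operator `D^s / s!` acts on any `n` elements as a combination of
the `D^i / i!`, `i < n`, with controlled coefficients (`dividedPow_eq_sum`). This is applied to a row of
the Taylor series `Y = ∑ G_[n](t_{0,r}) T^n` of the fundamental solution, in the completion of the
field of rational functions in `T` for the Gauss norm of radius `ρ` (`DiskField`). Since `Y` is
invertible and `(d/dT)^s Y` is the Taylor expansion of `G_s` times `Y`, the relation holds for the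
matrices `G_[s]` themselves. No cyclic vector is needed.
-/

namespace PadicDE

open Finset.HasAntidiagonal (antidiagonal mem_antidiagonal)
open Filter Topology UniformSpace

/-! ### Iterated Leibniz rules -/

/-- The iterated Leibniz rule for a biadditive product and operators satisfying the Leibniz rule. -/
lemma iterate_leibniz {M N P : Type*} [AddCommMonoid M] [AddCommMonoid N] [AddCommMonoid P]
    (B : M →+ N →+ P) (d₁ : M →+ M) (d₂ : N →+ N) (d₃ : P →+ P)
    (h : ∀ a b, d₃ (B a b) = B (d₁ a) b + B a (d₂ b)) (n : ℕ) (a : M) (b : N) :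
    d₃^[n] (B a b) = ∑ ij ∈ antidiagonal n,
      n.choose ij.1 • B (d₁^[ij.1] a) (d₂^[ij.2] b) := by
  induction n with
  | zero => simp
  | succ n ih =>
    rw [Finset.sum_antidiagonal_choose_succ_nsmul (fun i j => B (d₁^[i] a) (d₂^[j] b)) n,
      Function.iterate_succ_apply', ih, map_sum, ← Finset.sum_add_distrib]
    refine Finset.sum_congr rfl fun ij hij => ?_
    have hc : n.choose ij.2 = n.choose ij.1 := by
      rw [← mem_antidiagonal.1 hij, Nat.choose_symm_add]
    rw [map_nsmul, h, smul_add, Function.iterate_succ_apply', Function.iterate_succ_apply', hc,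
      add_comm]

/-- The additive map `D` is a derivation of the ring `R`. -/
def IsLeibniz {R : Type*} [CommRing R] (D : R →+ R) : Prop :=
  ∀ a b, D (a * b) = D a * b + a * D b

lemma IsLeibniz.map_one {R : Type*} [CommRing R] {D : R →+ R} (hD : IsLeibniz D) : D 1 = 0 := by
  have := hD 1 1
  simpa using this

lemma IsLeibniz.iterate_mul {R : Type*} [CommRing R] {D : R →+ R} (hD : IsLeibniz D) (n : ℕ)
    (a b : R) : D^[n] (a * b) =
      ∑ ij ∈ antidiagonal n, n.choose ij.1 • (D^[ij.1] a * D^[ij.2] b) :=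
  iterate_leibniz (AddMonoidHom.mul (R := R)) D D D hD n a b

/-! ### Derivations with bounded divided powers -/

section Bounded

variable {L : Type*} [NormedField L]

lemma norm_choose_mul_factorials_le (i j : ℕ) :
    ‖((i + j).factorial : L)‖ = ‖((i + j).choose i : L)‖ * (‖(i.factorial : L)‖ *
      ‖(j.factorial : L)‖) := by
  rw [← norm_mul, ← norm_mul, ← Nat.add_choose_mul_factorial_mul_factorial i j,
    Nat.choose_symm_add]
  push_cast
  rw [mul_assoc]

/-- The bound `|D^s x / s!| ≤ ρ^{-s} |x|` for all `s`. -/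
def DividedBound (D : L →+ L) (ρ : ℝ) (x : L) : Prop :=
  ∀ s : ℕ, ‖D^[s] x‖ * ρ ^ s ≤ ‖(s.factorial : L)‖ * ‖x‖

variable {D : L →+ L} {ρ : ℝ}

lemma DividedBound.term_le (hρ : 0 < ρ) {x y : L} {i j : ℕ} {cx cy : ℝ}
    (hx : ‖D^[i] x‖ * ρ ^ i ≤ ‖(i.factorial : L)‖ * cx)
    (hy : ‖D^[j] y‖ * ρ ^ j ≤ ‖(j.factorial : L)‖ * cy) :
    ‖(i + j).choose i • (D^[i] x * D^[j] y)‖ * ρ ^ (i + j) ≤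
      ‖((i + j).factorial : L)‖ * (cx * cy) := by
  rw [nsmul_eq_mul, norm_mul, norm_mul, norm_choose_mul_factorials_le, pow_add]
  calc _ = ‖((i + j).choose i : L)‖ * ((‖D^[i] x‖ * ρ ^ i) * (‖D^[j] y‖ * ρ ^ j)) := by ring
    _ ≤ ‖((i + j).choose i : L)‖ * ((‖(i.factorial : L)‖ * cx) * (‖(j.factorial : L)‖ * cy)) := by
      gcongr
      exact le_trans (by positivity) hx
    _ = _ := by ring

variable [IsUltrametricDist L]

lemma DividedBound.mul (hD : IsLeibniz D) (hρ : 0 < ρ) {x y : L} (hx : DividedBound D ρ x)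
    (hy : DividedBound D ρ y) : DividedBound D ρ (x * y) := by
  intro s
  rw [hD.iterate_mul, ← le_div_iff₀ (by positivity)]
  refine IsUltrametricDist.norm_sum_le_of_forall_le_of_nonneg (by positivity) fun ij hij => ?_
  rw [← mem_antidiagonal.1 hij, le_div_iff₀ (by positivity), norm_mul x y]
  exact DividedBound.term_le hρ (hx _) (hy _)

/-- The bound for the inverse follows from `D^s (x x⁻¹) = 0`. -/
lemma DividedBound.inv (hD : IsLeibniz D) (hρ : 0 < ρ) {x : L} (hx : DividedBound D ρ x) :
    DividedBound D ρ x⁻¹ := by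
  by_cases h0 : x = 0
  · simpa [h0] using hx
  have hx0 : 0 < ‖x‖ := norm_pos_iff.2 h0
  intro s
  induction s using Nat.strong_induction_on with
  | _ s ih =>
    rcases Nat.eq_zero_or_pos s with rfl | hs
    · simp
    have hz : D^[s] (x * x⁻¹) = 0 := by
      obtain ⟨t, rfl⟩ := Nat.exists_eq_succ_of_ne_zero hs.ne'
      rw [mul_inv_cancel₀ h0, Function.iterate_succ_apply, hD.map_one]
      exact iterate_map_zero D t
    rw [hD.iterate_mul, ← Finset.add_sum_erase _ _
      (show ((0, s) : ℕ × ℕ) ∈ antidiagonal s by simp)] at hz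
    have hz' := eq_neg_of_add_eq_zero_left hz
    simp only [Nat.choose_zero_right, one_smul, Function.iterate_zero, id] at hz'
    have hle : ‖x * D^[s] x⁻¹‖ ≤ ‖(s.factorial : L)‖ / ρ ^ s := by
      rw [hz', norm_neg]
      refine IsUltrametricDist.norm_sum_le_of_forall_le_of_nonneg (by positivity) fun ij hij => ?_
      obtain ⟨hne, hmem⟩ := Finset.mem_erase.1 hij
      have hsum := mem_antidiagonal.1 hmem
      have hlt : ij.2 < s := by
        rcases Nat.eq_zero_or_pos ij.1 with h | h
        · exact absurd (Prod.ext h (by simp; omega)) hne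
        · omega
      have := DividedBound.term_le hρ (hx ij.1) (ih ij.2 hlt)
      rw [hsum, norm_inv, mul_inv_cancel₀ hx0.ne', mul_one] at this
      rwa [le_div_iff₀ (by positivity)]
    rw [norm_mul, le_div_iff₀ (by positivity)] at hle
    rw [norm_inv, ← div_eq_mul_inv, le_div_iff₀ hx0]
    linarith

end Bounded

/-! ### The Gauss absolute value on rational functions -/

section RatGauss

variable {F : Type*} [NormedField F]

lemma ratDeriv_algebraMap (P : F[X]) : ratDeriv (algebraMap F[X] (RatFunc F) P) =
    algebraMap F[X] (RatFunc F) (derivative P) := by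
  rw [ratDeriv_eq (a := P) one_ne_zero (by simp)]
  simp

lemma ratDeriv_mul (f g : RatFunc F) : ratDeriv (f * g) = ratDeriv f * g + f * ratDeriv g := by
  have hf := f.denom_ne_zero
  have hg := g.denom_ne_zero
  have ef : algebraMap F[X] (RatFunc F) f.denom ≠ 0 := RatFunc.algebraMap_ne_zero hf
  have eg : algebraMap F[X] (RatFunc F) g.denom ≠ 0 := RatFunc.algebraMap_ne_zero hg
  have h : f * g = algebraMap F[X] (RatFunc F) (f.num * g.num) /
      algebraMap F[X] (RatFunc F) (f.denom * g.denom) := by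
    rw [_root_.map_mul, _root_.map_mul, ← div_mul_div_comm, f.num_div_denom, g.num_div_denom]
  rw [ratDeriv_eq (mul_ne_zero hf hg) h, ratDeriv, ratDeriv]
  have hf' := f.num_div_denom
  have hg' := g.num_div_denom
  generalize f.num = a, f.denom = b, g.num = c, g.denom = d at *
  subst hf' hg'
  simp only [_root_.map_mul, map_sub, map_pow, derivative_mul, map_add]
  field_simp
  ring

variable [IsUltrametricDist F]

lemma gaussPoint_ne_zero {ρ : ℝ} (hρ : 0 < ρ) {P : F[X]} (hP : P ≠ 0) :
    gaussPoint F ρ hρ P ≠ 0 := by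
  change P.gaussNorm (absVal F) ρ ≠ 0
  rwa [Ne, gaussNorm_eq_zero_iff _ _ (fun x hx => (absVal F).eq_zero.1 hx) hρ]

variable {ρ : ℝ} (hρ : 0 < ρ)

lemma gaussPoint_absRat_mul (f g : RatFunc F) : (gaussPoint F ρ hρ).absRat (f * g) =
    (gaussPoint F ρ hρ).absRat f * (gaussPoint F ρ hρ).absRat g := by
  set ξ := gaussPoint F ρ hρ
  have hf := gaussPoint_ne_zero hρ f.denom_ne_zero
  have hg := gaussPoint_ne_zero hρ g.denom_ne_zero
  have h : f * g = algebraMap F[X] (RatFunc F) (f.num * g.num) /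
      algebraMap F[X] (RatFunc F) (f.denom * g.denom) := by
    rw [_root_.map_mul, _root_.map_mul, ← div_mul_div_comm, f.num_div_denom, g.num_div_denom]
  rw [(ξ.absRat_eq (by rw [ξ.map_mul]; exact mul_ne_zero hf hg) h).2, ξ.map_mul, ξ.map_mul,
    ← div_mul_div_comm]
  rfl

lemma gaussPoint_absRat_add_le (f g : RatFunc F) : (gaussPoint F ρ hρ).absRat (f + g) ≤
    max ((gaussPoint F ρ hρ).absRat f) ((gaussPoint F ρ hρ).absRat g) := by
  set ξ := gaussPoint F ρ hρ
  have hf := gaussPoint_ne_zero hρ f.denom_ne_zero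
  have hg := gaussPoint_ne_zero hρ g.denom_ne_zero
  have h : f + g = algebraMap F[X] (RatFunc F) (f.num * g.denom + f.denom * g.num) /
      algebraMap F[X] (RatFunc F) (f.denom * g.denom) := by
    rw [map_add, _root_.map_mul, _root_.map_mul, _root_.map_mul,
      ← div_add_div _ _ (RatFunc.algebraMap_ne_zero f.denom_ne_zero)
      (RatFunc.algebraMap_ne_zero g.denom_ne_zero), f.num_div_denom, g.num_div_denom]
  have hf' := lt_of_le_of_ne (ξ.nonneg _) hf.symm
  have hg' := lt_of_le_of_ne (ξ.nonneg _) hg.symm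
  rw [(ξ.absRat_eq (by rw [ξ.map_mul]; exact mul_ne_zero hf hg) h).2, ξ.map_mul,
    div_le_iff₀ (mul_pos hf' hg')]
  refine (ξ.map_add_le_max' _ _).trans (le_of_eq ?_)
  rw [max_mul_of_nonneg _ _ (mul_pos hf' hg').le]
  rw [ξ.map_mul, ξ.map_mul]
  simp only [BerkovichLine.absRat]
  congr 1 <;> field_simp

/-- The Gauss absolute value of radius `ρ` on the field of rational functions. -/
noncomputable def ratGauss (F : Type*) [NormedField F] [IsUltrametricDist F] {ρ : ℝ} (hρ : 0 < ρ) :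
    AbsoluteValue (RatFunc F) ℝ where
  toFun := (gaussPoint F ρ hρ).absRat
  map_mul' := gaussPoint_absRat_mul hρ
  nonneg' := (gaussPoint F ρ hρ).absRat_nonneg
  eq_zero' f := by
    constructor
    · intro h
      by_contra hf
      exact div_ne_zero (gaussPoint_ne_zero hρ (RatFunc.num_ne_zero hf))
        (gaussPoint_ne_zero hρ f.denom_ne_zero) h
    · rintro rfl
      simp [BerkovichLine.absRat, BerkovichLine.map_zero]
  add_le' f g := (gaussPoint_absRat_add_le hρ f g).trans (max_le
    (le_add_of_nonneg_right (BerkovichLine.absRat_nonneg _ _))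
    (le_add_of_nonneg_left (BerkovichLine.absRat_nonneg _ _)))

lemma ratGauss_apply (f : RatFunc F) : ratGauss F hρ f = (gaussPoint F ρ hρ).absRat f := rfl

lemma ratGauss_algebraMap (P : F[X]) :
    ratGauss F hρ (algebraMap F[X] (RatFunc F) P) = gaussPoint F ρ hρ P := by
  rw [ratGauss_apply, ((gaussPoint F ρ hρ).absRat_eq (a := P) (b := 1)
    (gaussPoint_ne_zero hρ one_ne_zero) (by simp)).2, BerkovichLine.map_one, div_one]

instance : IsUltrametricDist (WithAbs (ratGauss F hρ)) :=
  IsUltrametricDist.isUltrametricDist_of_isNonarchimedean_norm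
    fun x y => gaussPoint_absRat_add_le hρ x.ofAbs y.ofAbs

/-- The derivation `d/dx` of the field of rational functions with its Gauss absolute value. -/
noncomputable def ratGaussDeriv : WithAbs (ratGauss F hρ) →+ WithAbs (ratGauss F hρ) :=
  AddMonoidHom.ofMapSub (fun x : WithAbs (ratGauss F hρ) =>
    WithAbs.toAbs (ratGauss F hρ) (ratDeriv x.ofAbs)) fun x y => by
      rw [WithAbs.ofAbs_sub, ratDeriv_sub, WithAbs.toAbs_sub]

lemma ratGaussDeriv_isLeibniz : IsLeibniz (ratGaussDeriv (F := F) hρ) := fun x y =>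
  congrArg (WithAbs.toAbs (ratGauss F hρ)) (ratDeriv_mul x.ofAbs y.ofAbs)

lemma ratGaussDeriv_apply (x : WithAbs (ratGauss F hρ)) :
    ratGaussDeriv hρ x = WithAbs.toAbs (ratGauss F hρ) (ratDeriv x.ofAbs) := rfl

lemma ratGaussDeriv_iterate_algebraMap (P : F[X]) (s : ℕ) : (ratGaussDeriv hρ)^[s]
      (WithAbs.toAbs (ratGauss F hρ) (algebraMap F[X] (RatFunc F) P)) =
    WithAbs.toAbs (ratGauss F hρ) (algebraMap F[X] (RatFunc F) (derivative^[s] P)) := by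
  induction s with
  | zero => rfl
  | succ s ih =>
    rw [Function.iterate_succ_apply', ih, ratGaussDeriv_apply, WithAbs.ofAbs_toAbs,
      ratDeriv_algebraMap, Function.iterate_succ_apply']

lemma norm_natCast_ratGauss (n : ℕ) : ‖(n : WithAbs (ratGauss F hρ))‖ = ‖(n : F)‖ := by
  have h : (n : WithAbs (ratGauss F hρ)) =
      WithAbs.toAbs (ratGauss F hρ) (algebraMap F[X] (RatFunc F) (C (n : F))) := by
    simp only [map_natCast]
    exact (map_natCast (WithAbs.equiv (ratGauss F hρ)).symm n).symm
  rw [h, WithAbs.norm_toAbs_eq, ratGauss_algebraMap, BerkovichLine.map_C]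

lemma ratGaussDeriv_bound (x : WithAbs (ratGauss F hρ)) : DividedBound (ratGaussDeriv hρ) ρ x := by
  have hpoly : ∀ P : F[X], DividedBound (ratGaussDeriv hρ) ρ
      (WithAbs.toAbs (ratGauss F hρ) (algebraMap F[X] (RatFunc F) P)) := by
    intro P s
    rw [norm_natCast_ratGauss, ratGaussDeriv_iterate_algebraMap, WithAbs.norm_toAbs_eq,
      WithAbs.norm_toAbs_eq, ratGauss_algebraMap, ratGauss_algebraMap]
    change (derivative^[s] P).gaussNorm (absVal F) ρ * ρ ^ s ≤ _ * P.gaussNorm (absVal F) ρ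
    obtain ⟨i, hi⟩ := (derivative^[s] P).exists_eq_gaussNorm (absVal F) ρ
    rw [hi, coeff_iterate_derivative, Nat.descFactorial_eq_factorial_mul_choose, nsmul_eq_mul,
      absVal_apply, norm_mul, Nat.cast_mul, norm_mul]
    have h1 := P.le_gaussNorm (absVal F) hρ.le (i + s)
    have h2 := IsUltrametricDist.norm_natCast_le_one F ((i + s).choose s)
    rw [absVal_apply] at h1
    calc _ = ‖(s.factorial : F)‖ * (‖((i + s).choose s : F)‖ *
          (‖P.coeff (i + s)‖ * ρ ^ (i + s))) := by rw [pow_add]; ring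
      _ ≤ ‖(s.factorial : F)‖ * (1 * P.gaussNorm (absVal F) ρ) := by gcongr
      _ = _ := by rw [one_mul]
  have hx : x = WithAbs.toAbs (ratGauss F hρ) (algebraMap F[X] (RatFunc F) x.ofAbs.num) *
      (WithAbs.toAbs (ratGauss F hρ) (algebraMap F[X] (RatFunc F) x.ofAbs.denom))⁻¹ := by
    rw [← div_eq_mul_inv, ← WithAbs.toAbs_div, RatFunc.num_div_denom, WithAbs.toAbs_ofAbs]
  rw [hx]
  exact (hpoly _).mul (ratGaussDeriv_isLeibniz hρ) hρ
    ((hpoly _).inv (ratGaussDeriv_isLeibniz hρ) hρ)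

end RatGauss

/-! ### Derivations of completions -/

section Completion

lemma IsLeibniz.completion {R : Type*} [SeminormedCommRing R] {D : R →+ R} (hD : IsLeibniz D)
    (hc : Continuous D) : IsLeibniz (D.completion hc) := by
  intro a b
  have h := D.continuous_completion hc
  induction a, b using Completion.induction_on₂ with
  | hp => exact isClosed_eq (by fun_prop) (by fun_prop)
  | ih a b =>
    rw [← Completion.coe_mul, D.completion_coe hc, D.completion_coe hc, D.completion_coe hc, hD,
      Completion.coe_add, Completion.coe_mul, Completion.coe_mul]

lemma completion_iterate_coe {R : Type*} [SeminormedCommRing R] {D : R →+ R}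
    (hc : Continuous D) (s : ℕ) (x : R) :
    (D.completion hc)^[s] (x : Completion R) = ((D^[s] x : R) : Completion R) := by
  induction s with
  | zero => rfl
  | succ s ih => rw [Function.iterate_succ_apply', Function.iterate_succ_apply', ih,
      D.completion_coe hc]

variable {L : Type*} [NormedField L]

lemma continuous_of_dividedBound {D : L →+ L} {ρ : ℝ} (hρ : 0 < ρ) (h : ∀ x, DividedBound D ρ x) :
    Continuous D := by
  refine AddMonoidHomClass.continuous_of_bound D (1 / ρ) fun x => ?_
  have := h x 1
  simp only [Function.iterate_one, pow_one, Nat.factorial_one, Nat.cast_one, norm_one,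
    one_mul] at this
  rw [div_mul_eq_mul_div, one_mul, le_div_iff₀ hρ]
  exact this

lemma norm_natCast_completion (n : ℕ) : ‖(n : Completion L)‖ = ‖(n : L)‖ := by
  rw [← map_natCast (Completion.coeRingHom (α := L)) n]
  exact Completion.norm_coe _

lemma DividedBound.completion {D : L →+ L} {ρ : ℝ} (h : ∀ x, DividedBound D ρ x)
    (hc : Continuous D) (x : Completion L) : DividedBound (D.completion hc) ρ x := by
  intro s
  have h' := (D.continuous_completion hc).iterate s
  induction x using Completion.induction_on with
  | hp => exact isClosed_le (by fun_prop) (by fun_prop)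
  | ih x =>
    rw [completion_iterate_coe, Completion.norm_coe, Completion.norm_coe,
      norm_natCast_completion]
    exact h x s

instance [IsUltrametricDist L] : IsUltrametricDist (Completion L) :=
  IsUltrametricDist.isUltrametricDist_of_isNonarchimedean_norm fun x y => by
    induction x, y using Completion.induction_on₂ with
    | hp => exact isClosed_le (by fun_prop) (by fun_prop)
    | ih x y =>
      rw [← Completion.coe_add, Completion.norm_coe, Completion.norm_coe, Completion.norm_coe]
      exact IsUltrametricDist.norm_add_le_max x y

end Completion

/-! ### The generic disk -/

/-- The field of the generic disk of radius `ρ` over `F`: the completion of the field of rational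
functions in one variable for the Gauss norm of radius `ρ`. -/
abbrev DiskField (F : Type*) [NormedField F] [IsUltrametricDist F] {ρ : ℝ} (hρ : 0 < ρ) : Type _ :=
  Completion (WithAbs (ratGauss F hρ))

namespace DiskField

variable {F : Type*} [NormedField F] [IsUltrametricDist F] {ρ : ℝ} (hρ : 0 < ρ)

variable (F) in
/-- The derivation `d/dT` of the field of the generic disk. -/
noncomputable def der : DiskField F hρ →+ DiskField F hρ :=
  (ratGaussDeriv (F := F) hρ).completion
    (continuous_of_dividedBound hρ (ratGaussDeriv_bound hρ))

lemma der_isLeibniz : IsLeibniz (der F hρ) := (ratGaussDeriv_isLeibniz hρ).completion _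

lemma continuous_der : Continuous (der F hρ) := AddMonoidHom.continuous_completion _ _

lemma der_bound (x : DiskField F hρ) : DividedBound (der F hρ) ρ x :=
  DividedBound.completion (ratGaussDeriv_bound hρ) _ x

variable (F) in
/-- Polynomials in the coordinate `T` of the generic disk. -/
noncomputable def ofPoly : F[X] →+* DiskField F hρ :=
  Completion.coeRingHom.comp
    ((WithAbs.equiv (ratGauss F hρ)).symm.toRingHom.comp (algebraMap F[X] (RatFunc F)))

lemma ofPoly_apply (P : F[X]) : ofPoly F hρ P =
    ((WithAbs.toAbs (ratGauss F hρ) (algebraMap F[X] (RatFunc F) P) :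
      WithAbs (ratGauss F hρ)) : DiskField F hρ) := rfl

lemma der_ofPoly (P : F[X]) : der F hρ (ofPoly F hρ P) = ofPoly F hρ (derivative P) := by
  rw [ofPoly_apply, ofPoly_apply, der, AddMonoidHom.completion_coe, ratGaussDeriv_apply,
    WithAbs.ofAbs_toAbs, ratDeriv_algebraMap]

lemma norm_ofPoly (P : F[X]) : ‖ofPoly F hρ P‖ = gaussPoint F ρ hρ P := by
  rw [ofPoly_apply, Completion.norm_coe, WithAbs.norm_toAbs_eq, ratGauss_algebraMap]

lemma norm_ofPoly_monomial (a : F) (n : ℕ) : ‖ofPoly F hρ (monomial n a)‖ = ‖a‖ * ρ ^ n := by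
  rw [norm_ofPoly]
  exact gaussNorm_monomial (absVal F) ρ n a

lemma norm_coeff_zero_le (P : F[X]) : ‖P.coeff 0‖ ≤ ‖ofPoly F hρ P‖ := by
  rw [norm_ofPoly]
  refine le_trans (le_of_eq ?_) (P.le_gaussNorm (absVal F) hρ.le 0)
  rw [pow_zero, mul_one, absVal_apply]

lemma norm_natCast (n : ℕ) : ‖(n : DiskField F hρ)‖ = ‖(n : F)‖ := by
  rw [norm_natCast_completion, norm_natCast_ratGauss]

end DiskField

/-! ### Finite rank bounds the divided powers of a derivation -/

section Rank

variable {K : Type*} [NormedField K]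

/-- The divided power `D^s / s!` of an additive map. -/
noncomputable def dividedPow (D : K →+ K) (s : ℕ) (x : K) : K := (s.factorial : K)⁻¹ * D^[s] x

variable {D : K →+ K}

lemma dividedPow_zero_right (s : ℕ) : dividedPow D s (0 : K) = 0 := by
  simp [dividedPow, iterate_map_zero]

lemma natCast_mul_dividedPow_succ [CharZero K] (s : ℕ) (x : K) :
    ((s + 1 : ℕ) : K) * dividedPow D (s + 1) x = dividedPow D s (D x) := by
  have h : ((s + 1 : ℕ) : K) ≠ 0 := Nat.cast_ne_zero.2 s.succ_ne_zero
  rw [dividedPow, dividedPow, Nat.factorial_succ, Nat.cast_mul, mul_inv, ← mul_assoc, ← mul_assoc,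
    mul_inv_cancel₀ h, one_mul, Function.iterate_succ_apply]

lemma dividedPow_mul [CharZero K] (hD : IsLeibniz D) (s : ℕ) (x y : K) :
    dividedPow D s (x * y) =
      ∑ ij ∈ antidiagonal s, dividedPow D ij.1 x * dividedPow D ij.2 y := by
  rw [dividedPow, hD.iterate_mul, Finset.mul_sum]
  refine Finset.sum_congr rfl fun ij hij => ?_
  rw [← mem_antidiagonal.1 hij, ← Nat.add_choose_mul_factorial_mul_factorial ij.1 ij.2]
  have h1 : (ij.1.factorial : K) ≠ 0 := Nat.cast_ne_zero.2 (Nat.factorial_ne_zero _)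
  have h2 : (ij.2.factorial : K) ≠ 0 := Nat.cast_ne_zero.2 (Nat.factorial_ne_zero _)
  have h3 : ((ij.1 + ij.2).choose ij.1 : K) ≠ 0 :=
    Nat.cast_ne_zero.2 (Nat.choose_pos (Nat.le_add_right _ _)).ne'
  rw [Nat.choose_symm_add] at *
  simp only [dividedPow, nsmul_eq_mul]
  push_cast
  field_simp

lemma norm_dividedPow_le [CharZero K] {ρ : ℝ} (hρ : 0 < ρ) {x : K} (hx : DividedBound D ρ x)
    (s : ℕ) : ‖dividedPow D s x‖ ≤ ‖x‖ / ρ ^ s := by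
  have h : 0 < ‖(s.factorial : K)‖ :=
    norm_pos_iff.2 (Nat.cast_ne_zero.2 (Nat.factorial_ne_zero _))
  rw [dividedPow, norm_mul, norm_inv, le_div_iff₀ (by positivity), mul_assoc, inv_mul_le_iff₀ h]
  exact hx s

variable [IsUltrametricDist K] [CharZero K]

/-- The Dwork–Robba bound: on `n` functions, the divided power `D^s / s!` is a combination of those
of order `< n`, with coefficients whose size is controlled by `n` factors `1/|λ|`, `1 ≤ λ ≤ s`.
The induction on `n` divides by one of the functions, so that it becomes constant, and uses
`D^s / s! = s⁻¹ (D^{s-1} / (s-1)!) D` to pass to the derivatives of the `n - 1` others. -/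
theorem dividedPow_eq_sum (hD : IsLeibniz D) {ρ : ℝ} (hρ : 0 < ρ)
    (hbd : ∀ x, DividedBound D ρ x) {B : ℝ} (hB : 1 ≤ B) {N : ℕ}
    (hN : ∀ j : ℕ, 1 ≤ j → j ≤ N → 1 ≤ B * ‖(j : K)‖) (n : ℕ) (u : Fin n → K) :
    ∀ s ≤ N, ∃ c : ℕ → K, (∀ i, ‖c i‖ * ρ ^ s ≤ B ^ n * ρ ^ i) ∧
      ∀ j, dividedPow D s (u j) = ∑ i ∈ Finset.range n, c i * dividedPow D i (u j) := by
  induction n with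
  | zero => exact fun s _ => ⟨0, fun i => by simpa using (pow_pos hρ i).le, fun j => j.elim0⟩
  | succ n ih =>
    by_cases h0 : u 0 = 0
    · intro s hs
      obtain ⟨c, hc, hu⟩ := ih (fun j => u j.succ) s hs
      refine ⟨fun i => if i < n then c i else 0, fun i => ?_, fun j => ?_⟩
      · beta_reduce
        split_ifs
        · refine (hc i).trans ?_
          gcongr
          omega
        · rw [norm_zero, zero_mul]
          positivity
      · beta_reduce
        rw [Finset.sum_range_succ, if_neg (lt_irrefl n), zero_mul, add_zero,
          Finset.sum_congr rfl fun i hi => by rw [if_pos (Finset.mem_range.1 hi)]]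
        refine Fin.cases ?_ (fun j => hu j) j
        rw [h0]
        simp [dividedPow_zero_right]
    · set v : Fin (n + 1) → K := fun j => (u 0)⁻¹ * u j with hv
      have hv0 : D (v 0) = 0 := by rw [hv]; simp only; rw [inv_mul_cancel₀ h0, hD.map_one]
      have hstep : ∀ s ≤ N, ∃ c : ℕ → K, (∀ i, ‖c i‖ * ρ ^ s ≤ B ^ (n + 1) * ρ ^ i) ∧
          ∀ j, dividedPow D s (v j) = ∑ i ∈ Finset.range (n + 1), c i * dividedPow D i (v j) := by
        intro s hs
        cases s with
        | zero =>
          refine ⟨fun i => if i = 0 then 1 else 0, fun i => ?_, fun j => ?_⟩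
          · beta_reduce
            split_ifs with h
            · subst h
              simpa using one_le_pow₀ hB
            · rw [norm_zero, zero_mul]
              positivity
          · simp
        | succ s =>
          obtain ⟨b, hb, hw⟩ := ih (fun j => D (v j.succ)) s (by omega)
          have hs0 : ((s + 1 : ℕ) : K) ≠ 0 := Nat.cast_ne_zero.2 s.succ_ne_zero
          refine ⟨fun i => ((s + 1 : ℕ) : K)⁻¹ * ((i : ℕ) : K) * b (i - 1), fun i => ?_,
            fun j => ?_⟩
          · cases i with
            | zero => simp only [Nat.cast_zero, mul_zero, zero_mul, norm_zero]; positivity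
            | succ i =>
              rw [norm_mul, norm_mul, norm_inv, Nat.add_sub_cancel]
              have h1 := hN (s + 1) (by omega) hs
              have h2 := IsUltrametricDist.norm_natCast_le_one K (i + 1)
              have h3 : ‖((s + 1 : ℕ) : K)‖⁻¹ ≤ B :=
                inv_le_of_inv_le₀ (by positivity) (by
                  rw [inv_le_iff_one_le_mul₀ (by positivity)]; linarith)
              calc _ = ‖((s + 1 : ℕ) : K)‖⁻¹ * ‖((i + 1 : ℕ) : K)‖ * (‖b i‖ * ρ ^ s) * ρ := by
                    ring
                _ ≤ B * 1 * (B ^ n * ρ ^ i) * ρ := by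
                    have := hb i
                    gcongr
                _ = _ := by ring
          · have key : ∀ x : K, dividedPow D s (D x) =
                  ∑ i ∈ Finset.range n, b i * dividedPow D i (D x) →
                dividedPow D (s + 1) x = ∑ i ∈ Finset.range (n + 1),
                  ((s + 1 : ℕ) : K)⁻¹ * ((i : ℕ) : K) * b (i - 1) * dividedPow D i x := by
              intro x hx
              rw [Finset.sum_range_succ']
              simp only [Nat.cast_zero, mul_zero, zero_mul, add_zero, Nat.add_sub_cancel]
              refine mul_left_cancel₀ hs0 ?_
              rw [natCast_mul_dividedPow_succ, hx, Finset.mul_sum]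
              refine Finset.sum_congr rfl fun i _ => ?_
              rw [← natCast_mul_dividedPow_succ]
              field_simp
            refine key _ ?_
            refine Fin.cases ?_ (fun j => hw j) j
            rw [hv0]
            simp [dividedPow_zero_right]
      intro s hs
      have huv : ∀ j, u j = u 0 * v j := fun j => by rw [hv]; field_simp
      choose c hc hcv using hstep
      -- `u 0 • (D^s / s!) • (u 0)⁻¹` expanded on both sides by the Leibniz rule
      set e : ℕ → ℕ → K := fun b i => if h : b ≤ N then c b h i else 0 with he
      have hebd : ∀ b i, ‖e b i‖ * ρ ^ b ≤ B ^ (n + 1) * ρ ^ i := by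
        intro b i
        simp only [he]
        split_ifs with h
        · exact hc b h i
        · rw [norm_zero, zero_mul]; positivity
      refine ⟨fun l => ∑ ab ∈ antidiagonal s, ∑ i ∈ Finset.range (n + 1), if l ≤ i then
        dividedPow D ab.1 (u 0) * e ab.2 i * dividedPow D (i - l) (u 0)⁻¹ else 0,
        fun l => ?_, fun j => ?_⟩
      · rw [← le_div_iff₀ (by positivity)]
        refine IsUltrametricDist.norm_sum_le_of_forall_le_of_nonneg (by positivity) fun ab hab => ?_
        refine IsUltrametricDist.norm_sum_le_of_forall_le_of_nonneg (by positivity) fun i _ => ?_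
        split_ifs with hli
        · obtain ⟨t, rfl⟩ := Nat.exists_eq_add_of_le hli
          rw [← mem_antidiagonal.1 hab, Nat.add_sub_cancel_left, norm_mul, norm_mul]
          have h1 := norm_dividedPow_le hρ (hbd (u 0)) ab.1
          have h2 := norm_dividedPow_le hρ (hbd (u 0)⁻¹) t
          have h3 := hebd ab.2 (l + t)
          rw [← le_div_iff₀ (by positivity)] at h3
          rw [norm_inv] at h2
          have hu0 : ‖u 0‖ ≠ 0 := norm_ne_zero_iff.2 h0
          calc _ ≤ ‖u 0‖ / ρ ^ ab.1 * (B ^ (n + 1) * ρ ^ (l + t) / ρ ^ ab.2) *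
                (‖u 0‖⁻¹ / ρ ^ t) := by gcongr
            _ = _ := by
              rw [pow_add ρ l, pow_add ρ ab.1]
              field_simp
        · rw [norm_zero]; positivity
      · rw [huv j, dividedPow_mul hD]
        simp_rw [Finset.sum_mul]
        rw [Finset.sum_comm]
        refine Finset.sum_congr rfl fun ab hab => ?_
        have hle : ab.2 ≤ N := by
          have := mem_antidiagonal.1 hab
          omega
        rw [hcv ab.2 hle j, Finset.mul_sum, Finset.sum_comm]
        refine Finset.sum_congr rfl fun i hi => ?_
        have hexp : v j = (u 0 * v j) * (u 0)⁻¹ := by field_simp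
        conv_lhs => rw [hexp]
        rw [dividedPow_mul hD, Finset.Nat.sum_antidiagonal_eq_sum_range_succ_mk, Finset.mul_sum,
          Finset.mul_sum]
        have hsub : Finset.range i.succ ⊆ Finset.range (n + 1) :=
          Finset.range_subset_range.2 (Finset.mem_range.1 hi)
        rw [← Finset.sum_subset hsub]
        · refine Finset.sum_congr rfl fun l hl => ?_
          rw [if_pos (Nat.lt_succ_iff.1 (Finset.mem_range.1 hl))]
          simp only [he, dif_pos hle]
          ring
        · intro l _ hl
          rw [if_neg (fun h => hl (Finset.mem_range.2 (Nat.lt_succ_iff.2 h))), zero_mul]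

end Rank

/-! ### Exponential series on the generic disk -/

namespace DiskField

variable {F : Type*} [NormedField F]

/-- The partial sums of `∑ aₙ T^n / n!`. -/
noncomputable def expPoly (a : ℕ → F) (N : ℕ) : F[X] :=
  ∑ n ∈ Finset.range N, monomial n (a n / n.factorial)

lemma coeff_zero_expPoly (a : ℕ → F) (N : ℕ) : (expPoly a (N + 1)).coeff 0 = a 0 := by
  simp [expPoly, coeff_monomial]

variable [IsUltrametricDist F] {ρ : ℝ} (hρ : 0 < ρ)

lemma charZero [CharZero F] : CharZero (DiskField F hρ) :=
  charZero_of_injective_ringHom ((ofPoly F hρ).comp C).injective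

/-- The monomial `a T^n / n!` on the generic disk. -/
noncomputable def expTerm (a : ℕ → F) (n : ℕ) : DiskField F hρ :=
  ofPoly F hρ (monomial n (a n / n.factorial))

/-- The sum `∑ aₙ T^n / n!` on the generic disk, meaningful when `ExpSummable ρ a`. -/
noncomputable def expSum (a : ℕ → F) : DiskField F hρ := ∑' n, expTerm hρ a n

/-- Absolute convergence of `∑ aₙ T^n / n!` for the Gauss norm of radius `ρ`. -/
def ExpSummable (ρ : ℝ) (a : ℕ → F) : Prop :=
  Summable fun n => ‖a n‖ / ‖(n.factorial : F)‖ * ρ ^ n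

variable {a b : ℕ → F}

lemma norm_expTerm (a : ℕ → F) (n : ℕ) :
    ‖expTerm hρ a n‖ = ‖a n‖ / ‖(n.factorial : F)‖ * ρ ^ n := by
  rw [expTerm, norm_ofPoly_monomial, norm_div]

lemma ExpSummable.norm (ha : ExpSummable ρ a) : Summable fun n => ‖expTerm hρ a n‖ := by
  simp only [norm_expTerm]
  exact ha

lemma ExpSummable.hasSum (ha : ExpSummable ρ a) : HasSum (expTerm hρ a) (expSum hρ a) :=
  (ha.norm hρ).of_norm.hasSum

include hρ in
lemma ExpSummable.shift [CharZero F] (ha : ExpSummable ρ a) : ExpSummable ρ fun n => a (n + 1) := by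
  have h := ((summable_nat_add_iff 1).2 ha).mul_right ρ⁻¹
  refine Summable.of_nonneg_of_le (fun n => by positivity) (fun n => ?_) h
  have h1 : 0 < ‖((n + 1 : ℕ) : F)‖ := norm_pos_iff.2 (Nat.cast_ne_zero.2 n.succ_ne_zero)
  have h2 : 0 < ‖(n.factorial : F)‖ := norm_pos_iff.2 (Nat.cast_ne_zero.2 n.factorial_ne_zero)
  have h3 := IsUltrametricDist.norm_natCast_le_one F (n + 1)
  rw [Nat.factorial_succ, Nat.cast_mul, norm_mul, pow_succ]
  calc ‖a (n + 1)‖ / ‖(n.factorial : F)‖ * ρ ^ n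
      ≤ ‖a (n + 1)‖ / (‖((n + 1 : ℕ) : F)‖ * ‖(n.factorial : F)‖) * ρ ^ n := by
        gcongr
        exact mul_le_of_le_one_left h2.le h3
    _ = _ := by field_simp

lemma der_expTerm_zero (a : ℕ → F) : der F hρ (expTerm hρ a 0) = 0 := by
  rw [expTerm, der_ofPoly]
  simp

lemma der_expTerm_succ [CharZero F] (a : ℕ → F) (n : ℕ) :
    der F hρ (expTerm hρ a (n + 1)) = expTerm hρ (fun n => a (n + 1)) n := by
  rw [expTerm, der_ofPoly, expTerm, derivative_monomial, Nat.add_sub_cancel, Nat.factorial_succ]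
  congr 2
  have h1 : ((n + 1 : ℕ) : F) ≠ 0 := Nat.cast_ne_zero.2 n.succ_ne_zero
  have h2 : (n.factorial : F) ≠ 0 := Nat.cast_ne_zero.2 n.factorial_ne_zero
  rw [Nat.cast_mul]
  field_simp

lemma der_expSum [CharZero F] (ha : ExpSummable ρ a) :
    der F hρ (expSum hρ a) = expSum hρ fun n => a (n + 1) := by
  have h := (ha.hasSum hρ).map (der F hρ) (continuous_der hρ)
  rw [← hasSum_nat_add_iff' 1] at h
  simp only [Function.comp_apply, der_expTerm_succ, Finset.range_one, Finset.sum_singleton,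
    der_expTerm_zero, sub_zero] at h
  exact h.unique ((ha.shift hρ).hasSum hρ)

lemma der_iterate_expSum [CharZero F] (ha : ExpSummable ρ a) (s : ℕ) :
    (der F hρ)^[s] (expSum hρ a) = expSum hρ fun n => a (n + s) := by
  induction s generalizing a with
  | zero => rfl
  | succ s ih =>
    rw [Function.iterate_succ_apply, der_expSum hρ ha, ih (ha.shift hρ)]
    simp only [add_assoc]

lemma expTerm_mul_expTerm [CharZero F] (a b : ℕ → F) (i j : ℕ) :
    expTerm hρ a i * expTerm hρ b j = ofPoly F hρ
      (monomial (i + j) ((i + j).choose i * (a i * b j) / (i + j).factorial)) := by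
  rw [expTerm, expTerm, ← _root_.map_mul, monomial_mul_monomial]
  congr 2
  have h1 : (i.factorial : F) ≠ 0 := Nat.cast_ne_zero.2 i.factorial_ne_zero
  have h2 : (j.factorial : F) ≠ 0 := Nat.cast_ne_zero.2 j.factorial_ne_zero
  have h3 : ((i + j).choose i : F) ≠ 0 :=
    Nat.cast_ne_zero.2 (Nat.choose_pos (Nat.le_add_right _ _)).ne'
  rw [← Nat.add_choose_mul_factorial_mul_factorial i j]
  rw [Nat.choose_symm_add] at *
  push_cast
  field_simp

lemma hasSum_expSum_mul [CharZero F] (ha : ExpSummable ρ a) (hb : ExpSummable ρ b) :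
    HasSum (expTerm hρ fun n => ∑ ij ∈ antidiagonal n, n.choose ij.1 * (a ij.1 * b ij.2))
      (expSum hρ a * expSum hρ b) := by
  have h := (summable_norm_sum_mul_antidiagonal_of_summable_norm (ha.norm hρ) (hb.norm hρ)).of_norm
  rw [expSum, expSum, tsum_mul_tsum_eq_tsum_sum_antidiagonal_of_summable_norm (ha.norm hρ)
    (hb.norm hρ)]
  refine h.hasSum.congr_fun fun n => ?_
  rw [expTerm, Finset.sum_div, map_sum, map_sum]
  refine Finset.sum_congr rfl fun ij hij => ?_
  rw [expTerm_mul_expTerm, mem_antidiagonal.1 hij]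

lemma norm_expSum_le {c : ℝ} (ha : ExpSummable ρ a)
    (h : ∀ n, ‖a n‖ / ‖(n.factorial : F)‖ * ρ ^ n ≤ c) : ‖expSum hρ a‖ ≤ c := by
  have hc : 0 ≤ c := le_trans (by positivity) (h 0)
  refine le_of_tendsto ((ha.hasSum hρ).tendsto_sum_nat.norm) (Eventually.of_forall fun N => ?_)
  exact IsUltrametricDist.norm_sum_le_of_forall_le_of_nonneg hc fun n _ => by
    rw [norm_expTerm]; exact h n

lemma tendsto_expPoly (ha : ExpSummable ρ a) :
    Tendsto (fun N => ofPoly F hρ (expPoly a (N + 1))) atTop (𝓝 (expSum hρ a)) := by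
  have h := (tendsto_add_atTop_iff_nat 1).2 (ha.hasSum hρ).tendsto_sum_nat
  simpa only [expPoly, map_sum, expTerm] using h

lemma norm_zero_le_expSum (ha : ExpSummable ρ a) : ‖a 0‖ ≤ ‖expSum hρ a‖ :=
  ge_of_tendsto (tendsto_expPoly hρ ha).norm (Eventually.of_forall fun N => by
    rw [← coeff_zero_expPoly a N]; exact norm_coeff_zero_le hρ _)

/-- A matrix of convergent series with value `1` at the origin is invertible. -/
lemma det_expSum_ne_zero {μ : ℕ} {Y : Matrix (Fin μ) (Fin μ) (ℕ → F)}
    (hY : ∀ i j, ExpSummable ρ (Y i j)) (h1 : Y.map (fun a => a 0) = 1) :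
    (Y.map (expSum hρ)).det ≠ 0 := by
  have hlim : Tendsto (fun N => ((Y.map fun a => expPoly a (N + 1)).map (ofPoly F hρ)).det) atTop
      (𝓝 (Y.map (expSum hρ)).det) := by
    refine (continuous_id.matrix_det.tendsto _).comp ?_
    exact tendsto_pi_nhds.2 fun i => tendsto_pi_nhds.2 fun j => tendsto_expPoly hρ (hY i j)
  have hge : 1 ≤ ‖(Y.map (expSum hρ)).det‖ := by
    refine ge_of_tendsto hlim.norm (Eventually.of_forall fun N => ?_)
    rw [show ((Y.map fun a => expPoly a (N + 1)).map (ofPoly F hρ)) =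
      (ofPoly F hρ).mapMatrix (Y.map fun a => expPoly a (N + 1)) from rfl, ← RingHom.map_det]
    refine le_trans (le_of_eq ?_) (norm_coeff_zero_le hρ _)
    rw [← constantCoeff_apply, RingHom.map_det]
    have : constantCoeff.mapMatrix (Y.map fun a => expPoly a (N + 1)) = 1 := by
      rw [← h1]
      ext i j
      exact coeff_zero_expPoly _ _
    rw [this, Matrix.det_one, norm_one]
  intro h
  rw [h, norm_zero] at hge
  linarith

end DiskField

/-! ### The Dwork–Robba bound for systems -/

section System

variable {A : Type*} [CommRing A] {μ : ℕ}

/-- The operator `M ↦ dM/dx + M G`, whose iterates at `1` are the matrices `G_s`. -/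
def sysDer (δ : A →+ A) (G : Matrix (Fin μ) (Fin μ) A) :
    Matrix (Fin μ) (Fin μ) A →+ Matrix (Fin μ) (Fin μ) A :=
  δ.mapMatrix + AddMonoidHom.mulRight G

lemma mapMatrix_iterate_apply (δ : A →+ A) (n : ℕ) (M : Matrix (Fin μ) (Fin μ) A) (i j : Fin μ) :
    (δ.mapMatrix (m := Fin μ) (n := Fin μ))^[n] M i j = δ^[n] (M i j) := by
  induction n generalizing M with
  | zero => rfl
  | succ n ih => rw [Function.iterate_succ_apply, Function.iterate_succ_apply, ih]; rfl

/-- `G_{n+s} = ∑ᵢ (n choose i) (d/dx)^i (G_s) G_{n-i}`. -/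
lemma sysDer_iterate_add {δ : A →+ A} (hδ : IsLeibniz δ) (G : Matrix (Fin μ) (Fin μ) A)
    (n s : ℕ) (i j : Fin μ) : (sysDer δ G)^[n + s] 1 i j =
      ∑ ab ∈ antidiagonal n, n.choose ab.1 * ∑ l, δ^[ab.1] ((sysDer δ G)^[s] 1 i l) *
        (sysDer δ G)^[ab.2] 1 l j := by
  have h := iterate_leibniz (AddMonoidHom.mul (R := Matrix (Fin μ) (Fin μ) A))
    (δ.mapMatrix (m := Fin μ) (n := Fin μ)) (sysDer δ G) (sysDer δ G) (fun M N => by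
      change (M * N).map δ + M * N * G = M.map δ * N + M * (N.map δ + N * G)
      rw [mul_add, ← add_assoc, mul_assoc]
      congr 1
      ext i j
      simp only [Matrix.map_apply, Matrix.mul_apply, Matrix.add_apply, map_sum, hδ _ _,
        Finset.sum_add_distrib]) n ((sysDer δ G)^[s] 1) 1
  rw [AddMonoidHom.mul_apply, mul_one, ← Function.iterate_add_apply] at h
  rw [h, Matrix.sum_apply]
  refine Finset.sum_congr rfl fun ab _ => ?_
  rw [Matrix.smul_apply, nsmul_eq_mul, AddMonoidHom.mul_apply, Matrix.mul_apply]
  simp only [mapMatrix_iterate_apply]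

variable {F : Type*} [NormedField F] [IsUltrametricDist F] [CharZero F]

open DiskField in
/-- The Dwork–Robba bound for a system. The Taylor series `Y = ∑ G_n T^n / n!` converges on the
generic disk of radius `ρ` and satisfies `(d/dT)^s Y = τ(G_s) Y`, where `τ` is the Taylor expansion,
an isometry for the Gauss norm. The bound on the divided powers of `d/dT` acting on a row of `Y`
then passes to `G_s / s!`, since `Y` is invertible. -/
theorem norm_sysDer_iterate_le {δ : A →+ A} (hδ : IsLeibniz δ) (ι : A →+* F) {r ρ : ℝ}
    (hρ : 0 < ρ) (hρr : ρ < r)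
    (hι : ∀ a s, ‖ι (δ^[s] a)‖ * r ^ s ≤ ‖(s.factorial : F)‖ * ‖ι a‖)
    (G : Matrix (Fin μ) (Fin μ) A)
    (hG : ∀ i j, ExpSummable ρ fun n => ι ((sysDer δ G)^[n] 1 i j))
    {B : ℝ} (hB : 1 ≤ B) {N : ℕ} (hN : ∀ j : ℕ, 1 ≤ j → j ≤ N → 1 ≤ B * ‖(j : F)‖)
    {c : ℝ} (hc0 : 0 ≤ c) (i j : Fin μ)
    (hc : ∀ q < μ, ‖ι ((sysDer δ G)^[q] 1 i j)‖ / ‖(q.factorial : F)‖ * ρ ^ q ≤ c)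
    {s : ℕ} (hs : s ≤ N) :
    ‖ι ((sysDer δ G)^[s] 1 i j)‖ / ‖(s.factorial : F)‖ * ρ ^ s ≤ B ^ μ * c := by
  have hchar := DiskField.charZero (F := F) hρ
  have hr : 0 < r := hρ.trans hρr
  have hfac : ∀ n : ℕ, 0 < ‖(n.factorial : F)‖ := fun n =>
    norm_pos_iff.2 (Nat.cast_ne_zero.2 n.factorial_ne_zero)
  have hterm : ∀ f n, ‖ι (δ^[n] f)‖ / ‖(n.factorial : F)‖ * ρ ^ n ≤ ‖ι f‖ * (ρ / r) ^ n := by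
    intro f n
    have h1 := hfac n
    rw [div_mul_eq_mul_div, div_le_iff₀ h1, div_pow, mul_div_assoc', div_mul_eq_mul_div,
      le_div_iff₀ (by positivity)]
    calc _ = ‖ι (δ^[n] f)‖ * r ^ n * ρ ^ n := by ring
      _ ≤ ‖(n.factorial : F)‖ * ‖ι f‖ * ρ ^ n := by
        have := hι f n
        gcongr
      _ = _ := by ring
  have hlt : ρ / r < 1 := (div_lt_one hr).2 hρr
  have hτ : ∀ f, ExpSummable ρ fun n => ι (δ^[n] f) := fun f =>
    Summable.of_nonneg_of_le (fun n => by positivity) (hterm f)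
      ((summable_geometric_of_lt_one (by positivity) hlt).mul_left _)
  have hτle : ∀ f, ‖expSum hρ fun n => ι (δ^[n] f)‖ ≤ ‖ι f‖ := fun f =>
    norm_expSum_le hρ (hτ f) fun n => (hterm f n).trans
      (mul_le_of_le_one_right (norm_nonneg _) (pow_le_one₀ (by positivity) hlt.le))
  have hτge : ∀ f, ‖ι f‖ ≤ ‖expSum hρ fun n => ι (δ^[n] f)‖ := fun f =>
    norm_zero_le_expSum hρ (hτ f)
  set Y : Matrix (Fin μ) (Fin μ) (ℕ → F) :=
    Matrix.of fun i j n => ι ((sysDer δ G)^[n] 1 i j) with hYdef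
  have hYs : ∀ i j, ExpSummable ρ (Y i j) := hG
  have hdet : (Y.map (expSum hρ)).det ≠ 0 := det_expSum_ne_zero hρ hYs (by
    ext i j
    simp [hYdef, Matrix.one_apply, apply_ite ι])
  have hder : ∀ s b, (der F hρ)^[s] (expSum hρ (Y i b)) =
      ∑ l, (expSum hρ fun n => ι (δ^[n] ((sysDer δ G)^[s] 1 i l))) * expSum hρ (Y l b) := by
    intro s b
    rw [der_iterate_expSum hρ (hYs i b)]
    refine HasSum.tsum_eq ?_
    have h := hasSum_sum (s := Finset.univ) fun l (_ : l ∈ Finset.univ) =>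
      hasSum_expSum_mul hρ (hτ ((sysDer δ G)^[s] 1 i l)) (hYs l b)
    convert h using 2 with n
    simp only [expTerm]
    rw [← map_sum, ← map_sum, ← Finset.sum_div]
    congr 3
    rw [hYdef, Matrix.of_apply, sysDer_iterate_add hδ, map_sum, Finset.sum_comm]
    refine Finset.sum_congr rfl fun ab _ => ?_
    simp [Finset.mul_sum]
  obtain ⟨e, he, hrow⟩ := dividedPow_eq_sum (der_isLeibniz hρ) hρ (der_bound hρ) hB
    (by simpa only [DiskField.norm_natCast] using hN) μ (fun b => expSum hρ (Y i b)) s hs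
  set τ : ℕ → Fin μ → DiskField F hρ := fun s l => (s.factorial : DiskField F hρ)⁻¹ *
    expSum hρ fun n => ι (δ^[n] ((sysDer δ G)^[s] 1 i l)) with hτdef
  have hdp : ∀ s b, dividedPow (der F hρ) s (expSum hρ (Y i b)) =
      ∑ l, τ s l * expSum hρ (Y l b) := by
    intro s b
    rw [dividedPow, hder, Finset.mul_sum]
    simp only [hτdef, mul_assoc]
  have hzero : (fun l => τ s l - ∑ q ∈ Finset.range μ, e q * τ q l) = 0 := by
    refine Matrix.eq_zero_of_vecMul_eq_zero hdet ?_
    ext b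
    simp only [Matrix.vecMul, dotProduct, Matrix.map_apply, Pi.zero_apply, sub_mul,
      Finset.sum_sub_distrib, Finset.sum_mul]
    rw [← hdp, hrow, Finset.sum_comm, ← Finset.sum_sub_distrib]
    refine Finset.sum_eq_zero fun q _ => ?_
    rw [hdp, Finset.mul_sum, sub_eq_zero]
    simp only [mul_assoc]
  have hτs : τ s j = ∑ q ∈ Finset.range μ, e q * τ q j := sub_eq_zero.1 (congrFun hzero j)
  have hnorm : ∀ q, ‖τ q j‖ = ‖expSum hρ fun n => ι (δ^[n] ((sysDer δ G)^[q] 1 i j))‖ /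
      ‖(q.factorial : F)‖ := fun q => by
    rw [hτdef, norm_mul, norm_inv, DiskField.norm_natCast, inv_mul_eq_div]
  have hBμ : 0 ≤ B ^ μ * c := by positivity
  calc ‖ι ((sysDer δ G)^[s] 1 i j)‖ / ‖(s.factorial : F)‖ * ρ ^ s
      ≤ ‖τ s j‖ * ρ ^ s := by
        rw [hnorm]
        gcongr
        exact hτge _
    _ ≤ B ^ μ * c := by
      rw [← le_div_iff₀ (by positivity), hτs]
      refine IsUltrametricDist.norm_sum_le_of_forall_le_of_nonneg (by positivity) fun q hq => ?_
      rw [le_div_iff₀ (by positivity), norm_mul, hnorm]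
      have h1 := hc q (Finset.mem_range.1 hq)
      have h2 := he q
      have h3 := hτle ((sysDer δ G)^[q] 1 i j)
      calc _ ≤ ‖e q‖ * (‖ι ((sysDer δ G)^[q] 1 i j)‖ / ‖(q.factorial : F)‖) * ρ ^ s := by gcongr
        _ = (‖e q‖ * ρ ^ s) * (‖ι ((sysDer δ G)^[q] 1 i j)‖ / ‖(q.factorial : F)‖) := by ring
        _ ≤ (B ^ μ * ρ ^ q) * (‖ι ((sysDer δ G)^[q] 1 i j)‖ / ‖(q.factorial : F)‖) := by gcongr
        _ = B ^ μ * (‖ι ((sysDer δ G)^[q] 1 i j)‖ / ‖(q.factorial : F)‖ * ρ ^ q) := by ring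
        _ ≤ _ := by gcongr

end System

/-! ### Analytic elements at the Gauss points -/

section Evaluation

lemma continuous_gaussNorm {k : Type*} [NormedField k] (P : k[X]) :
    Continuous fun t : ℝ => P.gaussNorm (absVal k) t := by
  by_cases h : P.support.Nonempty
  · simp only [gaussNorm, h, dif_pos]
    exact Continuous.finset_sup'_apply h fun i _ => by fun_prop
  · simp only [gaussNorm, h, dif_neg, not_false_eq_true]
    exact continuous_const

variable {k : Type*} [NontriviallyNormedField k] [IsUltrametricDist k] {U : Annulus}

namespace AnalyticElement

variable {r : ℝ} (hr : r ∈ Set.Icc U.r₁ U.r₂)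

/-- A rational function as an element of the completion of `k(x)` at the Gauss point. -/
noncomputable def ratEval : RatFuncOn k U →+* DiskField k (U.pos.trans_le hr.1) :=
  Completion.coeRingHom.comp
    ((WithAbs.equiv (ratGauss k (U.pos.trans_le hr.1))).symm.toRingHom.comp
      (ratFuncSubalgebra k U).val.toRingHom)

lemma norm_ratEval (f : RatFuncOn k U) :
    ‖ratEval hr f‖ = f.absAt (gaussPoint k r (U.pos.trans_le hr.1)) :=
  Completion.norm_coe _

end AnalyticElement

variable [CompleteSpace k]

/-- The derivation `d/dx` on rational functions without poles in the annulus, as an additive map. -/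
noncomputable def RatFuncOn.derivHom (k : Type*) [NontriviallyNormedField k] [IsUltrametricDist k]
    [CompleteSpace k] (U : Annulus) : RatFuncOn k U →+ RatFuncOn k U :=
  AddMonoidHom.ofMapSub RatFuncOn.deriv RatFuncOn.deriv_sub

lemma RatFuncOn.continuous_derivHom : Continuous (RatFuncOn.derivHom k U) :=
  RatFuncOn.uniformContinuous_deriv.continuous

lemma RatFuncOn.derivHom_isLeibniz : IsLeibniz (RatFuncOn.derivHom k U) := fun f g =>
  Subtype.ext (ratDeriv_mul f.toRat g.toRat)

namespace AnalyticElement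

/-- The derivation `d/dx` of analytic elements, as an additive map. -/
noncomputable def derivHom (k : Type*) [NontriviallyNormedField k] [IsUltrametricDist k]
    [CompleteSpace k] (U : Annulus) : AnalyticElement k U →+ AnalyticElement k U :=
  (RatFuncOn.derivHom k U).completion RatFuncOn.continuous_derivHom

lemma derivHom_apply (f : AnalyticElement k U) : derivHom k U f = deriv f := rfl

lemma derivHom_isLeibniz : IsLeibniz (derivHom k U) := RatFuncOn.derivHom_isLeibniz.completion _

lemma continuous_derivHom : Continuous (derivHom k U) := AddMonoidHom.continuous_completion _ _

variable {r : ℝ} (hr : r ∈ Set.Icc U.r₁ U.r₂)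

lemma der_ratEval (f : RatFuncOn k U) :
    DiskField.der k (U.pos.trans_le hr.1) (ratEval hr f) = ratEval hr f.deriv :=
  AddMonoidHom.completion_coe _ _ _

lemma continuous_ratEval : Continuous (ratEval (k := k) hr) :=
  AddMonoidHomClass.continuous_of_bound (ratEval (k := k) hr) 1 fun f => by
    rw [norm_ratEval, one_mul]
    exact f.absAt_gaussPoint_le hr

/-- The evaluation of analytic elements at the point `t_{0,r}`, with values in the completion of
`k(x)` for the Gauss norm of radius `r`. -/
noncomputable def eval : AnalyticElement k U →+* DiskField k (U.pos.trans_le hr.1) :=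
  Completion.extensionHom (ratEval hr) (continuous_ratEval hr)

lemma eval_coe (f : RatFuncOn k U) : eval hr (f : AnalyticElement k U) = ratEval hr f :=
  Completion.extensionHom_coe _ _ _

lemma continuous_eval : Continuous (eval (k := k) hr) := Completion.continuous_extension

lemma norm_eval (f : AnalyticElement k U) :
    ‖eval hr f‖ = absAt (gaussPoint k r (U.pos.trans_le hr.1)) f := by
  have h1 := continuous_eval (k := k) hr
  have h2 : Continuous (absAt (U := U) (gaussPoint k r (U.pos.trans_le hr.1))) :=
    Completion.continuous_extension
  induction f using Completion.induction_on with
  | hp => exact isClosed_eq (by fun_prop) h2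
  | ih f => rw [eval_coe, norm_ratEval, absAt_coe f hr]

lemma norm_eval_le (f : AnalyticElement k U) : ‖eval hr f‖ ≤ ‖f‖ := by
  have h1 := continuous_eval (k := k) hr
  induction f using Completion.induction_on with
  | hp => exact isClosed_le (by fun_prop) (by fun_prop)
  | ih f =>
    rw [eval_coe, norm_ratEval, Completion.norm_coe]
    exact f.absAt_gaussPoint_le hr

lemma eval_derivHom (f : AnalyticElement k U) :
    eval hr (derivHom k U f) = DiskField.der k (U.pos.trans_le hr.1) (eval hr f) := by
  have h1 := continuous_eval (k := k) hr
  have h2 := continuous_derivHom (k := k) (U := U)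
  have h3 := DiskField.continuous_der (F := k) (U.pos.trans_le hr.1)
  induction f using Completion.induction_on with
  | hp => exact isClosed_eq (by fun_prop) (by fun_prop)
  | ih f =>
    rw [eval_coe, der_ratEval, derivHom_apply, deriv_coe, eval_coe]

lemma eval_derivHom_iterate (f : AnalyticElement k U) (s : ℕ) :
    eval hr ((derivHom k U)^[s] f) = (DiskField.der k (U.pos.trans_le hr.1))^[s] (eval hr f) := by
  induction s with
  | zero => rfl
  | succ s ih => rw [Function.iterate_succ_apply', Function.iterate_succ_apply', eval_derivHom, ih]

lemma norm_eval_derivHom_iterate_le (f : AnalyticElement k U) (s : ℕ) :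
    ‖eval hr ((derivHom k U)^[s] f)‖ * r ^ s ≤
      ‖(s.factorial : DiskField k (U.pos.trans_le hr.1))‖ * ‖eval hr f‖ := by
  rw [eval_derivHom_iterate]
  exact DiskField.der_bound _ _ s

lemma norm_ratEval_smul (a : k) (f : RatFuncOn k U) :
    ‖ratEval hr (a • f)‖ = ‖a‖ * ‖ratEval hr f‖ := by
  rw [norm_ratEval, norm_ratEval, Algebra.smul_def, RatFuncOn.absAt_mul _ _
    (RatFuncOn.gaussPoint_denom_ne _ _ _) (RatFuncOn.gaussPoint_denom_ne _ _ _),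
    RatFuncOn.absAt_algebraMap]

lemma norm_eval_smul (a : k) (f : AnalyticElement k U) :
    ‖eval hr (a • f)‖ = ‖a‖ * ‖eval hr f‖ := by
  have h1 := (continuous_eval (k := k) hr).norm
  refine Completion.induction_on f (isClosed_eq (h1.comp (continuous_const_smul a))
    (h1.const_mul _)) fun f => ?_
  rw [← Completion.coe_smul, eval_coe, eval_coe, norm_ratEval_smul]

/-- `r ↦ |f(t_{0,r})|` is continuous on `[r₁, r₂]`. -/
lemma continuous_absAt (f : AnalyticElement k U) : Continuous fun r : Set.Icc U.r₁ U.r₂ =>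
    absAt (gaussPoint k r.1 (U.pos.trans_le r.2.1)) f := by
  refine continuous_of_uniform_approx_of_continuous fun V hV => ?_
  obtain ⟨ε, hε, hV⟩ := Metric.mem_uniformity_dist.1 hV
  obtain ⟨_, hg, g, rfl⟩ :=
    Metric.dense_iff.1 (Completion.denseRange_coe (α := RatFuncOn k U)) f ε hε
  refine ⟨fun r => g.absAt (gaussPoint k r.1 (U.pos.trans_le r.2.1)), ?_, fun r => hV ?_⟩
  · refine Continuous.div ((continuous_gaussNorm _).comp continuous_subtype_val)
      ((continuous_gaussNorm _).comp continuous_subtype_val) fun r => ?_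
    exact g.gaussPoint_denom_ne r.1 (U.pos.trans_le r.2.1)
  · beta_reduce
    rw [← absAt_coe g r.2, ← norm_eval r.2, ← norm_eval r.2, Real.dist_eq]
    refine (abs_norm_sub_norm_le _ _).trans_lt ?_
    rw [← map_sub]
    refine (norm_eval_le r.2 _).trans_lt ?_
    rwa [← dist_eq_norm, dist_comm, ← Metric.mem_ball]

end AnalyticElement

end Evaluation

/-! ### Growth of the matrices `G_[s]` at the Gauss points -/

lemma norm_factorial_pos {k : Type*} [NormedField k] [CharZero k] (n : ℕ) :
    0 < ‖(n.factorial : k)‖ :=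
  norm_pos_iff.2 (Nat.cast_ne_zero.2 n.factorial_ne_zero)

namespace System

variable {k : Type*} [NontriviallyNormedField k] [IsUltrametricDist k] [CompleteSpace k]
variable {U : Annulus} {μ : ℕ} (G : Matrix (Fin μ) (Fin μ) (AnalyticElement k U))

open AnalyticElement

lemma iter_eq (s : ℕ) : iter G s = (sysDer (derivHom k U) G)^[s] 1 := by
  induction s with
  | zero => rfl
  | succ s ih => rw [Function.iterate_succ_apply', ← ih]; rfl

/-- `|G_[s](t_{0,r})|`. -/
noncomputable def size (s : ℕ) (r : Set.Icc U.r₁ U.r₂) : ℝ :=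
  matAbsAt (gaussPoint k r.1 (U.pos.trans_le r.2.1)) (dividedIter G s)

variable {G} (r : Set.Icc U.r₁ U.r₂)

lemma norm_eval_dividedIter (s : ℕ) (i j : Fin μ) :
    ‖eval r.2 ((sysDer (derivHom k U) G)^[s] 1 i j)‖ /
        ‖(s.factorial : DiskField k (U.pos.trans_le r.2.1))‖ =
      absAt (gaussPoint k r.1 (U.pos.trans_le r.2.1)) (dividedIter G s i j) := by
  rw [← norm_eval r.2, dividedIter, Matrix.smul_apply, norm_eval_smul, iter_eq, norm_inv,
    DiskField.norm_natCast, inv_mul_eq_div]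

lemma le_size (s : ℕ) (i j : Fin μ) :
    ‖eval r.2 ((sysDer (derivHom k U) G)^[s] 1 i j)‖ /
        ‖(s.factorial : DiskField k (U.pos.trans_le r.2.1))‖ ≤ size G s r := by
  rw [norm_eval_dividedIter]
  exact le_ciSup (f := fun ij : Fin μ × Fin μ => absAt (gaussPoint k r.1 (U.pos.trans_le r.2.1))
    (dividedIter G s ij.1 ij.2)) (Set.finite_range _).bddAbove (i, j)

lemma size_le {s : ℕ} {c : ℝ} (hc : 0 ≤ c)
    (h : ∀ i j, ‖eval r.2 ((sysDer (derivHom k U) G)^[s] 1 i j)‖ /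
        ‖(s.factorial : DiskField k (U.pos.trans_le r.2.1))‖ ≤ c) : size G s r ≤ c :=
  Real.iSup_le (fun ij => by rw [← norm_eval_dividedIter]; exact h _ _) hc

lemma size_nonneg (s : ℕ) : 0 ≤ size G s r :=
  Real.iSup_nonneg fun ij => by rw [← norm_eval_dividedIter]; positivity

variable (G) in
lemma continuous_size (s : ℕ) : Continuous (size G s) := by
  rcases isEmpty_or_nonempty (Fin μ × Fin μ) with h | h
  · have : size G s = fun _ => 0 := by
      ext r
      exact Real.iSup_of_isEmpty _
    rw [this]
    exact continuous_const
  · have : size G s = fun r => Finset.univ.sup' Finset.univ_nonempty fun ij : Fin μ × Fin μ =>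
        absAt (gaussPoint k r.1 (U.pos.trans_le r.2.1)) (dividedIter G s ij.1 ij.2) := by
      ext r
      exact (Finset.sup'_univ_eq_ciSup _).symm
    rw [this]
    exact Continuous.finset_sup'_apply _ fun ij _ => continuous_absAt _

/-- `|G_{n+s}| ≤ |n!| M |G_s|` as soon as `M` bounds `r^{j-n} |G_[j]|` for `j ≤ n`. -/
lemma size_add_le [CharZero k] {n : ℕ} {M : ℝ}
    (hM : ∀ j ≤ n, size G j r * r.1 ^ j ≤ M * r.1 ^ n) (s : ℕ) :
    ‖((n + s).factorial : k)‖ * size G (n + s) r ≤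
      ‖(n.factorial : k)‖ * M * (‖(s.factorial : k)‖ * size G s r) := by
  have hr : 0 < r.1 := U.pos.trans_le r.2.1
  have hM0 : 0 ≤ M := by
    have := (mul_nonneg (size_nonneg (G := G) r 0) (pow_nonneg hr.le 0)).trans (hM 0 n.zero_le)
    exact nonneg_of_mul_nonneg_left this (by positivity)
  have hent : ∀ q i j, ‖eval r.2 ((sysDer (derivHom k U) G)^[q] 1 i j)‖ ≤
      ‖(q.factorial : k)‖ * size G q r := fun q i j => by
    have h := le_size (G := G) r q i j
    rw [DiskField.norm_natCast, div_le_iff₀ (norm_factorial_pos q)] at h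
    linarith
  rw [mul_comm, ← le_div_iff₀ (norm_factorial_pos _)]
  have hpos : 0 ≤ ‖(n.factorial : k)‖ * M * (‖(s.factorial : k)‖ * size G s r) := by
    have := size_nonneg (G := G) r s
    positivity
  refine size_le r (by positivity) fun i j => ?_
  rw [DiskField.norm_natCast]
  refine div_le_div_of_nonneg_right ?_ (norm_nonneg _)
  rw [sysDer_iterate_add derivHom_isLeibniz, map_sum]
  refine IsUltrametricDist.norm_sum_le_of_forall_le_of_nonneg hpos fun ab hab => ?_
  rw [Finset.mul_sum, map_sum]
  refine IsUltrametricDist.norm_sum_le_of_forall_le_of_nonneg hpos fun l _ => ?_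
  rw [_root_.map_mul, _root_.map_mul, map_natCast, norm_mul, norm_mul, DiskField.norm_natCast]
  have hn := mem_antidiagonal.1 hab
  have h1 := norm_eval_derivHom_iterate_le r.2 ((sysDer (derivHom k U) G)^[s] 1 i l) ab.1
  rw [DiskField.norm_natCast, ← le_div_iff₀ (by positivity)] at h1
  have h2 := hent ab.2 l j
  have h3 := hM ab.2 (by omega)
  have h4 := hent s i l
  have h5 := size_nonneg (G := G) r ab.2
  have h6 := size_nonneg (G := G) r s
  rw [← hn, pow_add, ← mul_assoc, mul_le_mul_iff_of_pos_right (by positivity)] at h3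
  rw [← hn, norm_choose_mul_factorials_le ab.1 ab.2]
  calc _ ≤ ‖((ab.1 + ab.2).choose ab.1 : k)‖ * ((‖(ab.1.factorial : k)‖ *
        (‖(s.factorial : k)‖ * size G s r) / r.1 ^ ab.1) *
        (‖(ab.2.factorial : k)‖ * (M * r.1 ^ ab.1))) := by
        gcongr
        · exact h1.trans (by gcongr)
        · exact h2.trans (by gcongr)
    _ = _ := by field_simp

/-- `ρ ≤ |a|^{-1/s}` in `[0, ∞]` means `|a| ρ^s ≤ 1`. -/
lemma ofReal_le_rpow_iff {a ρ : ℝ} (hρ : 0 < ρ) {s : ℕ} (hs : s ≠ 0) :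
    ENNReal.ofReal ρ ≤ ENNReal.ofReal a ^ (-(1 / (s : ℝ))) ↔ a * ρ ^ s ≤ 1 := by
  have hs' : 0 < (s : ℝ) := by exact_mod_cast Nat.pos_of_ne_zero hs
  rw [ENNReal.rpow_neg, ENNReal.le_inv_iff_le_inv, one_div,
    ENNReal.rpow_inv_le_iff hs', ENNReal.rpow_natCast, ← ENNReal.ofReal_inv_of_pos hρ,
    ← ENNReal.ofReal_pow (by positivity), ENNReal.ofReal_le_ofReal_iff (by positivity), inv_pow,
    ← one_div, le_div_iff₀ (by positivity)]

lemma le_radiusTilde {L c : ℝ} (hL : 0 < L) (h : ∀ s, size G s r * L ^ s ≤ c) :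
    ENNReal.ofReal L ≤ radiusTilde G (gaussPoint k r.1 (U.pos.trans_le r.2.1)) := by
  refine le_of_forall_lt fun x hx => ?_
  obtain ⟨y, hxy, hyL⟩ := exists_between hx
  have hy : y ≠ ⊤ := (hyL.trans_le le_top).ne
  have hy0 : 0 < y.toReal := ENNReal.toReal_pos (bot_lt_iff_ne_bot.1 (bot_le.trans_lt hxy)) hy
  rw [← ENNReal.ofReal_toReal hy] at hxy hyL
  rw [ENNReal.ofReal_lt_ofReal_iff hL] at hyL
  refine hxy.trans_le (le_liminf_of_le (by isBoundedDefault) ?_)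
  have hq : y.toReal / L < 1 := (div_lt_one hL).2 hyL
  have hlim : Tendsto (fun s : ℕ => c * (y.toReal / L) ^ s) atTop (𝓝 0) := by
    simpa using (tendsto_pow_atTop_nhds_zero_of_lt_one (by positivity) hq).const_mul c
  filter_upwards [hlim.eventually (ge_mem_nhds one_pos), eventually_ne_atTop 0] with s hs hs0
  refine (ofReal_le_rpow_iff hy0 hs0).2 (le_trans ?_ hs)
  calc _ = size G s r * L ^ s * (y.toReal / L) ^ s := by
        rw [size, div_pow]; field_simp
    _ ≤ _ := by
      gcongr
      exact h s

lemma summable_of_lt_radiusTilde {ρ : ℝ} (hρ : 0 < ρ)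
    (h : ENNReal.ofReal ρ < radiusTilde G (gaussPoint k r.1 (U.pos.trans_le r.2.1))) :
    Summable fun s => size G s r * ρ ^ s := by
  obtain ⟨y, hρy, hy⟩ := exists_between h
  have hyt : y ≠ ⊤ := (hy.trans_le le_top).ne
  have hy0 : 0 < y.toReal := ENNReal.toReal_pos (bot_lt_iff_ne_bot.1 (bot_le.trans_lt hρy)) hyt
  rw [← ENNReal.ofReal_toReal hyt] at hρy hy
  rw [ENNReal.ofReal_lt_ofReal_iff hy0] at hρy
  have hq : ρ / y.toReal < 1 := (div_lt_one hy0).2 hρy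
  refine Summable.of_norm_bounded_eventually_nat
    (summable_geometric_of_lt_one (by positivity) hq) ?_
  filter_upwards [eventually_lt_of_lt_liminf hy, eventually_ne_atTop 0] with s hs hs0
  have hs1 := (ofReal_le_rpow_iff hy0 hs0).1 hs.le
  rw [Real.norm_of_nonneg (mul_nonneg (size_nonneg r s) (by positivity))]
  calc _ = size G s r * y.toReal ^ s * (ρ / y.toReal) ^ s := by
        rw [div_pow]; field_simp
    _ ≤ 1 * (ρ / y.toReal) ^ s := by
      gcongr
      exact hs1
    _ = _ := one_mul _

/-- The Dwork–Robba bound at `t_{0,r}`, for radii below the radius of convergence. -/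
lemma size_mul_pow_le [CharZero k] {ρ : ℝ} (hρ : 0 < ρ)
    (hρr : ρ < radius G r.1 (U.pos.trans_le r.2.1))
    {B : ℝ} (hB : 1 ≤ B) {N : ℕ} (hN : ∀ j : ℕ, 1 ≤ j → j ≤ N → 1 ≤ B * ‖(j : k)‖)
    {c : ℝ} (hc0 : 0 ≤ c) (hc : ∀ q < μ, size G q r * r.1 ^ q ≤ c) {s : ℕ} (hs : s ≤ N) :
    size G s r * ρ ^ s ≤ B ^ μ * c := by
  have hr : 0 < r.1 := U.pos.trans_le r.2.1
  have hchar := DiskField.charZero (F := k) hr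
  rw [radius, ← ENNReal.ofReal_lt_iff_lt_toReal hρ.le (by simp), lt_min_iff,
    ENNReal.ofReal_lt_ofReal_iff hr] at hρr
  rw [← le_div_iff₀ (by positivity)]
  refine size_le r (by positivity) fun i j => ?_
  rw [le_div_iff₀ (by positivity)]
  refine norm_sysDer_iterate_le derivHom_isLeibniz (eval r.2) hρ hρr.1
    (norm_eval_derivHom_iterate_le r.2) G (fun i j => ?_) hB
    (by simpa only [DiskField.norm_natCast] using hN) hc0 i j (fun q hq => ?_) hs
  · refine Summable.of_nonneg_of_le (fun n => by positivity) (fun n => ?_)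
      (summable_of_lt_radiusTilde r hρ hρr.2)
    gcongr
    exact le_size r n i j
  · refine le_trans ?_ (hc q hq)
    have := size_nonneg (G := G) r q
    gcongr
    · exact le_size r q i j
    · exact hρr.1.le

end System

/-! ### Absolute values of integers and factorials -/

section Padic

variable {k : Type*} [NormedField k] [IsUltrametricDist k] {p : ℕ}

lemma norm_natCast_eq_one_of_not_dvd (hp' : p.Prime) (hp : ‖(p : k)‖ < 1) {m : ℕ} (hm : ¬ p ∣ m) :
    ‖(m : k)‖ = 1 := by
  refine le_antisymm (IsUltrametricDist.norm_natCast_le_one k m) ?_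
  have hcop : IsCoprime (m : ℤ) (p : ℤ) :=
    Nat.isCoprime_iff_coprime.2 ((Nat.Prime.coprime_iff_not_dvd hp').2 hm).symm
  obtain ⟨a, b, hab⟩ := hcop
  have h1 : (1 : k) = (a : k) * m + (b : k) * p := by
    simpa using congrArg (Int.cast : ℤ → k) hab.symm
  have ha := IsUltrametricDist.norm_intCast_le_one k a
  have hb := IsUltrametricDist.norm_intCast_le_one k b
  have h2 : (1 : ℝ) ≤ max (‖(a : k)‖ * ‖(m : k)‖) (‖(b : k)‖ * ‖(p : k)‖) := by
    rw [← norm_mul, ← norm_mul]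
    calc (1 : ℝ) = ‖(1 : k)‖ := norm_one.symm
      _ ≤ _ := by rw [h1]; exact IsUltrametricDist.norm_add_le_max _ _
  rcases le_max_iff.1 h2 with h | h
  · exact h.trans (mul_le_of_le_one_left (norm_nonneg _) ha)
  · have := mul_le_of_le_one_left (norm_nonneg (p : k)) hb
    linarith

lemma norm_natCast_eq_pow [hp' : Fact p.Prime] (hp : ‖(p : k)‖ < 1) {m : ℕ} (hm : m ≠ 0) :
    ‖(m : k)‖ = ‖(p : k)‖ ^ padicValNat p m := by
  obtain ⟨e, n, hn, rfl⟩ := Nat.exists_eq_pow_mul_and_not_dvd hm p hp'.out.ne_one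
  have hn0 : n ≠ 0 := by rintro rfl; exact hn (dvd_zero p)
  rw [padicValNat.mul (pow_ne_zero _ hp'.out.ne_zero) hn0, padicValNat.prime_pow,
    padicValNat.eq_zero_of_not_dvd hn, add_zero, Nat.cast_mul, norm_mul,
    norm_natCast_eq_one_of_not_dvd hp'.out hp hn, mul_one, Nat.cast_pow, norm_pow]

lemma one_le_pow_mul_norm_natCast [hp' : Fact p.Prime] [CharZero k] (hp : ‖(p : k)‖ < 1) {h j : ℕ}
    (hj : 1 ≤ j) (hjh : j ≤ p ^ h) : 1 ≤ (‖(p : k)‖⁻¹) ^ h * ‖(j : k)‖ := by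
  have hp0 : 0 < ‖(p : k)‖ := norm_pos_iff.2 (Nat.cast_ne_zero.2 hp'.out.ne_zero)
  rw [norm_natCast_eq_pow hp (Nat.one_le_iff_ne_zero.1 hj), inv_pow, inv_mul_eq_div,
    one_le_div (by positivity)]
  refine pow_le_pow_of_le_one hp0.le hp.le ?_
  exact (Nat.pow_le_pow_iff_right hp'.out.one_lt).1
    ((Nat.le_of_dvd hj pow_padicValNat_dvd).trans hjh)

lemma sub_one_mul_padicValNat_factorial_prime_pow [hp' : Fact p.Prime] (h : ℕ) :
    (p - 1) * padicValNat p (p ^ h).factorial + 1 = p ^ h := by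
  induction h with
  | zero => simp
  | succ h ih =>
    rw [pow_succ', padicValNat_factorial_mul, mul_add, add_right_comm, ih]
    obtain ⟨q, rfl⟩ := Nat.exists_eq_add_of_le hp'.out.one_lt.le
    rw [Nat.add_sub_cancel_left]
    ring

/-- With `ω = |p|^{1/(p-1)}`: `|s!| ≥ ω^s` for all `s`, and `ω |n!| = ω^n` for `n` a power
of `p`. -/
lemma exists_norm_factorial [hp' : Fact p.Prime] [CharZero k] (hp : ‖(p : k)‖ < 1) :
    ∃ ω : ℝ, 0 < ω ∧ ω ≤ 1 ∧ (∀ s : ℕ, ω ^ s ≤ ‖(s.factorial : k)‖) ∧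
      ∀ h : ℕ, ω * ‖((p ^ h).factorial : k)‖ = ω ^ p ^ h := by
  have hp0 : 0 < ‖(p : k)‖ := norm_pos_iff.2 (Nat.cast_ne_zero.2 hp'.out.ne_zero)
  have hp1 : p - 1 ≠ 0 := Nat.sub_ne_zero_of_lt hp'.out.one_lt
  set ω : ℝ := ‖(p : k)‖ ^ ((p - 1 : ℕ) : ℝ)⁻¹ with hω
  have hω1 : ω ≤ 1 := Real.rpow_le_one hp0.le hp.le (by positivity)
  have hω0 : 0 < ω := Real.rpow_pos_of_pos hp0 _
  have hωp : ω ^ (p - 1) = ‖(p : k)‖ := Real.rpow_inv_natCast_pow hp0.le hp1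
  have hfac : ∀ s : ℕ, ‖(s.factorial : k)‖ = ω ^ ((p - 1) * padicValNat p s.factorial) :=
    fun s => by rw [norm_natCast_eq_pow hp s.factorial_ne_zero, pow_mul, hωp]
  refine ⟨ω, hω0, hω1, fun s => ?_, fun h => ?_⟩
  · rw [hfac]
    refine pow_le_pow_of_le_one hω0.le hω1 ?_
    rw [sub_one_mul_padicValNat_factorial]
    exact Nat.sub_le _ _
  · rw [hfac, ← pow_succ', sub_one_mul_padicValNat_factorial_prime_pow]

end Padic

/-! ### Continuity of the radius of convergence -/

namespace System

variable {k : Type*} [NontriviallyNormedField k] [IsUltrametricDist k] [CompleteSpace k]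
variable {U : Annulus} {μ : ℕ} (G : Matrix (Fin μ) (Fin μ) (AnalyticElement k U))

/-- `max_{j ≤ n} max (1, r^j |G_[j](t_{0,r})|)`. -/
noncomputable def growth (n : ℕ) (r : Set.Icc U.r₁ U.r₂) : ℝ :=
  (Finset.range (n + 1)).sup' Finset.nonempty_range_add_one fun j => max 1 (size G j r * r.1 ^ j)

lemma continuous_growth (n : ℕ) : Continuous (growth G n) :=
  Continuous.finset_sup'_apply _ fun j _ => by
    have := continuous_size G j
    fun_prop

variable {G} (r : Set.Icc U.r₁ U.r₂)

lemma one_le_growth (n : ℕ) : 1 ≤ growth G n r :=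
  (le_max_left _ _).trans (Finset.le_sup' (fun j => max 1 (size G j r * r.1 ^ j))
    (Finset.mem_range.2 n.succ_pos))

lemma size_le_growth {n j : ℕ} (hj : j ≤ n) : size G j r * r.1 ^ j ≤ growth G n r :=
  (le_max_right _ _).trans (Finset.le_sup' (fun j => max 1 (size G j r * r.1 ^ j))
    (Finset.mem_range.2 (Nat.lt_succ_iff.2 hj)))

lemma growth_le {n : ℕ} {c : ℝ} (hc : 1 ≤ c) (h : ∀ j ≤ n, size G j r * r.1 ^ j ≤ c) :
    growth G n r ≤ c :=
  Finset.sup'_le _ _ fun j hj => max_le hc (h j (Nat.lt_succ_iff.1 (Finset.mem_range.1 hj)))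

variable (G) in
lemma exists_growth_le (n : ℕ) : ∃ c : ℝ, 1 ≤ c ∧ ∀ r, growth G n r ≤ c := by
  have : CompactSpace (Set.Icc U.r₁ U.r₂) := isCompact_iff_compactSpace.1 isCompact_Icc
  obtain ⟨c, hc⟩ := (isCompact_range (continuous_growth G n)).bddAbove
  exact ⟨c, (one_le_growth ⟨U.r₁, le_rfl, U.lt.le⟩ n).trans (hc ⟨_, rfl⟩), fun r => hc ⟨r, rfl⟩⟩

lemma radius_le : radius G r.1 (U.pos.trans_le r.2.1) ≤ r.1 := by
  have hr : 0 < r.1 := U.pos.trans_le r.2.1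
  exact ENNReal.toReal_le_of_le_ofReal hr.le (min_le_left _ _)

lemma le_radius {L : ℝ} (hL : L ≤ r.1)
    (h : ENNReal.ofReal L ≤ radiusTilde G (gaussPoint k r.1 (U.pos.trans_le r.2.1))) :
    L ≤ radius G r.1 (U.pos.trans_le r.2.1) :=
  (ENNReal.ofReal_le_iff_le_toReal (by simp)).1 (le_min (ENNReal.ofReal_le_ofReal hL) h)

variable [CharZero k]

lemma norm_factorial_mul_size_le {n : ℕ} {M : ℝ} (hM0 : 0 ≤ M)
    (hM : ∀ j ≤ n, size G j r * r.1 ^ j ≤ M * r.1 ^ n) (m l : ℕ) :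
    ‖((n * m + l).factorial : k)‖ * size G (n * m + l) r ≤
      (‖(n.factorial : k)‖ * M) ^ m * (‖(l.factorial : k)‖ * size G l r) := by
  induction m with
  | zero => simp
  | succ m ih =>
    have h := size_add_le r hM (n * m + l)
    rw [show n + (n * m + l) = n * (m + 1) + l by ring] at h
    refine h.trans ?_
    rw [pow_succ', mul_assoc (‖(n.factorial : k)‖ * M)]
    gcongr

/-- The lower bound `R ≥ r (ω / N_n)^{1/n}` of the radius by the first `n = p^h` matrices
`G_[j]`. -/
lemma mul_pow_le_radius_pow {ω : ℝ} (hω0 : 0 < ω) (hω1 : ω ≤ 1)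
    (hω : ∀ s : ℕ, ω ^ s ≤ ‖(s.factorial : k)‖) {n : ℕ} (hn : n ≠ 0)
    (hωn : ω * ‖(n.factorial : k)‖ = ω ^ n) :
    ω * r.1 ^ n ≤ radius G r.1 (U.pos.trans_le r.2.1) ^ n * growth G n r := by
  have hr : 0 < r.1 := U.pos.trans_le r.2.1
  have hg1 := one_le_growth (G := G) r n
  have hg0 : 0 < growth G n r := one_pos.trans_le hg1
  -- with this `L`, the bound `|G_{nm+l}| ≤ (|n!| r^{-n} N_n)^m |G_l|` keeps `|G_[s]| L^s` bounded
  set L : ℝ := r.1 * (ω / growth G n r) ^ ((n : ℝ)⁻¹) with hLdef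
  have hL0 : 0 < L := mul_pos hr (Real.rpow_pos_of_pos (by positivity) _)
  have hLn : L ^ n = r.1 ^ n * (ω / growth G n r) := by
    rw [hLdef, mul_pow, Real.rpow_inv_natCast_pow (by positivity) hn]
  have hLr : L ≤ r.1 := mul_le_of_le_one_right hr.le
    (Real.rpow_le_one (by positivity) (div_le_one_of_le₀ (hω1.trans hg1) hg0.le) (by positivity))
  have hM : ∀ j ≤ n, size G j r * r.1 ^ j ≤ growth G n r / r.1 ^ n * r.1 ^ n := fun j hj => by
    rw [div_mul_cancel₀ _ (by positivity)]
    exact size_le_growth r hj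
  obtain ⟨c, hc0, hc⟩ : ∃ c : ℝ, 0 ≤ c ∧ ∀ l < n,
      ω⁻¹ ^ l * (‖(l.factorial : k)‖ * size G l r) * L ^ l ≤ c := by
    refine ⟨∑ l ∈ Finset.range n, ω⁻¹ ^ l * (‖(l.factorial : k)‖ * size G l r) * L ^ l,
      Finset.sum_nonneg fun l _ => ?_, fun l hl => Finset.single_le_sum
        (f := fun l => ω⁻¹ ^ l * (‖(l.factorial : k)‖ * size G l r) * L ^ l) (fun l _ => ?_)
        (Finset.mem_range.2 hl)⟩
    all_goals
      have := size_nonneg (G := G) r l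
      positivity
  have hR : ENNReal.ofReal L ≤ radiusTilde G (gaussPoint k r.1 hr) := by
    refine le_radiusTilde (c := c) r hL0 fun s => ?_
    have hs := norm_factorial_mul_size_le r (by positivity) hM (s / n) (s % n)
    rw [Nat.div_add_mod] at hs
    have h1 := hc (s % n) (Nat.mod_lt _ (Nat.pos_of_ne_zero hn))
    have h2 := size_nonneg (G := G) r s
    have h3 := hω s
    refine le_trans ?_ h1
    have hωs : ω ^ s = (ω ^ n) ^ (s / n) * ω ^ (s % n) := by
      rw [← pow_mul, ← pow_add, Nat.div_add_mod]
    have hLs : L ^ s = (L ^ n) ^ (s / n) * L ^ (s % n) := by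
      rw [← pow_mul, ← pow_add, Nat.div_add_mod]
    have h4 : ω ^ s * size G s r ≤ _ := (mul_le_mul_of_nonneg_right h3 h2).trans hs
    rw [← mul_le_mul_iff_of_pos_left (show 0 < ω ^ s by positivity), ← mul_assoc]
    refine (mul_le_mul_of_nonneg_right h4 (by positivity : 0 ≤ L ^ s)).trans (le_of_eq ?_)
    -- the powers with exponent `s / n` cancel, since `|n!| (M / r^n) L^n = ω^n`
    have hcancel : ‖(n.factorial : k)‖ * (growth G n r / r.1 ^ n) * L ^ n = ω ^ n := by
      rw [hLn, ← hωn]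
      field_simp
    rw [hωs, hLs, ← hcancel, mul_pow _ (L ^ n), inv_pow]
    field_simp
  have hle := le_radius r hLr hR
  calc ω * r.1 ^ n = L ^ n * growth G n r := by rw [hLn]; field_simp
    _ ≤ _ := by gcongr

lemma radius_pos {p : ℕ} [Fact p.Prime] (hp : ‖(p : k)‖ < 1) :
    0 < radius G r.1 (U.pos.trans_le r.2.1) := by
  obtain ⟨ω, hω0, hω1, hω, hωp⟩ := exists_norm_factorial hp
  have hr : 0 < r.1 := U.pos.trans_le r.2.1
  have h := mul_pow_le_radius_pow (G := G) r hω0 hω1 hω one_ne_zero (by simp)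
  rw [pow_one, pow_one] at h
  exact pos_of_mul_pos_left ((mul_pos hω0 hr).trans_le h)
    (zero_le_one.trans (one_le_growth (G := G) r 1))

/-- The upper bound for the radius, from the Dwork–Robba bound. -/
lemma radius_pow_mul_growth_le (h0 : 0 < radius G r.1 (U.pos.trans_le r.2.1))
    {B : ℝ} (hB : 1 ≤ B) {n : ℕ}
    (hn : ∀ j : ℕ, 1 ≤ j → j ≤ n → 1 ≤ B * ‖(j : k)‖)
    {c : ℝ} (hc1 : 1 ≤ c) (hc : growth G μ r ≤ c) :
    radius G r.1 (U.pos.trans_le r.2.1) ^ n * growth G n r ≤ B ^ μ * c * r.1 ^ n := by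
  have hr : 0 < r.1 := U.pos.trans_le r.2.1
  set R := radius G r.1 (U.pos.trans_le r.2.1) with hR
  have hRr : R ≤ r.1 := radius_le r
  have key : ∀ ρ ∈ Set.Ioo 0 R, ρ ^ n * growth G n r ≤ B ^ μ * c * r.1 ^ n := by
    intro ρ hρ
    have hρ0 : 0 < ρ := hρ.1
    have hρr : ρ ≤ r.1 := hρ.2.le.trans hRr
    rw [mul_comm, ← le_div_iff₀ (by positivity)]
    have h1 : 1 ≤ B ^ μ * c := one_le_mul_of_one_le_of_one_le (one_le_pow₀ hB) hc1
    have h2 : ρ ^ n ≤ r.1 ^ n := by gcongr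
    refine growth_le r ?_ fun j hj => ?_
    · rw [one_le_div (by positivity)]
      exact h2.trans (le_mul_of_one_le_left (by positivity) h1)
    · rw [le_div_iff₀ (by positivity)]
      obtain ⟨i, rfl⟩ := Nat.exists_eq_add_of_le hj
      have h3 := size_mul_pow_le r hρ0 hρ.2 hB hn (zero_le_one.trans hc1)
        (fun q hq => (size_le_growth r hq.le).trans hc) (Nat.le_add_right j i)
      calc size G j r * r.1 ^ j * ρ ^ (j + i) = size G j r * ρ ^ j * r.1 ^ j * ρ ^ i := by ring
        _ ≤ B ^ μ * c * r.1 ^ j * r.1 ^ i := by gcongr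
        _ = _ := by ring
  have hcl : R ∈ closure (Set.Ioo 0 R) := by
    rw [closure_Ioo h0.ne]
    exact ⟨h0.le, le_rfl⟩
  have hclosed : IsClosed {ρ : ℝ | ρ ^ n * growth G n r ≤ B ^ μ * c * r.1 ^ n} :=
    isClosed_le (by fun_prop) continuous_const
  exact hclosed.closure_subset_iff.2 key hcl

lemma continuous_log_radius {p : ℕ} [hp' : Fact p.Prime] (hp : ‖(p : k)‖ < 1) :
    Continuous fun r : Set.Icc U.r₁ U.r₂ => Real.log (radius G r.1 (U.pos.trans_le r.2.1)) := by
  obtain ⟨ω, hω0, hω1, hω, hωp⟩ := exists_norm_factorial hp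
  obtain ⟨c, hc1, hc⟩ := exists_growth_le G μ
  have hp0 : 0 < ‖(p : k)‖ := norm_pos_iff.2 (Nat.cast_ne_zero.2 hp'.out.ne_zero)
  set β : ℝ := ‖(p : k)‖⁻¹ with hβ
  have hβ1 : 1 ≤ β := (one_le_inv₀ hp0).2 hp.le
  -- bounds the distance of `log R` to the approximation with `n = p^h`
  set E : ℕ → ℝ := fun h => (h * (μ * Real.log β) + (Real.log c - Real.log ω)) / (p : ℝ) ^ h with hE
  have hElim : Tendsto E atTop (𝓝 0) := by
    have hp1 : (1 : ℝ) < p := by exact_mod_cast hp'.out.one_lt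
    have h1 := (tendsto_pow_const_div_const_pow_of_one_lt 1 hp1).mul_const (μ * Real.log β)
    have h2 := (tendsto_pow_const_div_const_pow_of_one_lt 0 hp1).mul_const
      (Real.log c - Real.log ω)
    have h3 := h1.add h2
    simp only [zero_mul, add_zero] at h3
    refine h3.congr fun h => ?_
    simp only [hE]
    ring
  have hunif : TendstoUniformly (fun (h : ℕ) (r : Set.Icc U.r₁ U.r₂) =>
      Real.log r.1 - Real.log (growth G (p ^ h) r) / (p : ℝ) ^ h)
      (fun r => Real.log (radius G r.1 (U.pos.trans_le r.2.1))) atTop := by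
    rw [Metric.tendstoUniformly_iff]
    intro ε hε
    filter_upwards [hElim.eventually (gt_mem_nhds hε)] with h hh r
    refine lt_of_le_of_lt ?_ hh
    have hr : 0 < r.1 := U.pos.trans_le r.2.1
    have hR := radius_pos (G := G) r hp
    have hn0 : p ^ h ≠ 0 := pow_ne_zero _ hp'.out.ne_zero
    have hlow := mul_pow_le_radius_pow (G := G) r hω0 hω1 hω hn0 (hωp h)
    have hup := radius_pow_mul_growth_le (G := G) r hR (one_le_pow₀ hβ1 (n := h))
      (fun j h1 h2 => one_le_pow_mul_norm_natCast hp h1 h2) hc1 (hc r)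
    have hg : 0 < growth G (p ^ h) r := one_pos.trans_le (one_le_growth r _)
    have hlow' := Real.log_le_log (by positivity) hlow
    have hup' := Real.log_le_log (by positivity) hup
    rw [Real.log_mul (by positivity) (by positivity),
      Real.log_mul (by positivity) (by positivity), Real.log_pow, Real.log_pow] at hlow'
    rw [Real.log_mul (by positivity) (by positivity),
      Real.log_mul (by positivity) (by positivity),
      Real.log_mul (by positivity) (by positivity), Real.log_pow, Real.log_pow, Real.log_pow,
      Real.log_pow] at hup'
    have hlc : 0 ≤ Real.log c := Real.log_nonneg hc1
    have hlω : Real.log ω ≤ 0 := Real.log_nonpos hω0.le hω1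
    have hlβ : 0 ≤ μ * Real.log β := mul_nonneg (by positivity) (Real.log_nonneg hβ1)
    have hhβ : 0 ≤ h * (μ * Real.log β) := mul_nonneg (by positivity) hlβ
    have hpn : (0 : ℝ) < (p : ℝ) ^ h := by
      have : 0 < (p : ℝ) := by exact_mod_cast hp'.out.pos
      positivity
    push_cast at hlow' hup'
    rw [Real.dist_eq, hE]
    simp only
    rw [le_div_iff₀ hpn, ← abs_of_pos hpn, ← abs_mul, abs_of_pos hpn, abs_le]
    have hdiv : Real.log (growth G (p ^ h) r) / (p : ℝ) ^ h * (p : ℝ) ^ h =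
      Real.log (growth G (p ^ h) r) := div_mul_cancel₀ _ hpn.ne'
    constructor <;> nlinarith
  refine hunif.continuous (Eventually.of_forall fun h => ?_).frequently
  refine Continuous.sub (Continuous.log continuous_subtype_val fun r => ?_)
    ((Continuous.log (continuous_growth G _) fun r => ?_).div_const _)
  · exact (U.pos.trans_le r.2.1).ne'
  · exact (one_pos.trans_le (one_le_growth r _)).ne'

end System

end PadicDE

theorem mainTheorem7 (p : ℕ) [Fact p.Prime] {k : Type*} [NontriviallyNormedField k]
    [IsUltrametricDist k] [CompleteSpace k] [CharZero k] (hp : ‖(p : k)‖ < 1)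
    (U : PadicDE.Annulus) (μ : ℕ)
    (G : Matrix (Fin μ) (Fin μ) (PadicDE.AnalyticElement k U)) :
    (∀ r : Set.Icc U.r₁ U.r₂, 0 < PadicDE.System.radius G r.1 (U.pos.trans_le r.2.1)) ∧
      Continuous fun r : Set.Icc U.r₁ U.r₂ =>
        PadicDE.System.radius G r.1 (U.pos.trans_le r.2.1) := by
  refine ⟨fun r => PadicDE.System.radius_pos r hp, ?_⟩
  refine (Real.continuous_exp.comp (PadicDE.System.continuous_log_radius (G := G) hp)).congr
    fun r => Real.exp_log (PadicDE.System.radius_pos r hp)
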